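/- Consider $N=m_1+m_2$ bosonic modes with Hilbert space $L^2(\mathbb R^{N})$, quadratures $R=(q_1,\dots,q_N,p_1,\dots,p_N)$ with $[q_k,p_l]=i\delta_{kl}$, and Hamiltonian $H=\tfrac12\sum_{i=1}^{N}(q_i^2+p_i^2)$, split into a part $\mathcal A_1$ of $m_1$ modes and a part $\mathcal A_2$ of $m_2$ modes. A displacement-free pure Gaussian state is a state $\rho=|\psi\rangle\langle\psi|$ whose characteristic function is $\langle\psi, e^{i c\cdot R}\psi\rangle=e^{-\frac14 c^{T}\Sigma c}$ for all $c\in\mathbb R^{2N}$, for some real symmetric matrix $\Sigma$. A Gaussian unitary is a unitary $U$ with $U^\dagger R\,U=SR+d$ for a real symplectic matrix $S$ and a real vector $d$. The $2$-local ergotropic gap of $\rho$ is $$\delta^{\mathcal A_1|\mathcal A_2}_{2\text{-loc}}(\rho)=\mathcal E_G(\rho)-\mathcal E^{\mathcal A_1|\mathcal A_2}_{2\text{-loc}}(\rho),$$ where $$\mathcal E_G(\rho)=\operatorname{Tr}(\rho H)-\inf_{U}\operatorname{Tr}(U\rho U^\dagger H),\qquad \mathcal E^{\mathcal A_1|\mathcal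 A_2}_{2\text{-loc}}(\rho)=\operatorname{Tr}(\rho H)-\inf_{U_1\otimes U_2}\operatorname{Tr}\big((U_1\otimes U_2)\rho (U_1\otimes U_2)^\dagger H\big),$$ with $U$ running over the Gaussian unitaries on all $N$ modes and $U_j$ over the Gaussian unitaries on the modes of $\mathcal A_j$. The mutual information is $\mathrm{MI}(\rho)=S(\rho_{\mathcal A_1})+S(\rho_{\mathcal A_2})-S(\rho)$, where $\rho_{\mathcal A_j}$ is the reduced state on $\mathcal A_j$ and $S(\sigma)=-\operatorname{Tr}(\sigma\ln\sigma)$ is the von Neumann entropy. **Proposition.** Let $2\le m_1\le m_2$. Then the $2$-local ergotropic gap is not a function of the mutual information: there is no function $F:\mathbb R\to\mathbb R$ such that $$\delta^{\mathcal A_1|\mathcal A_2}_{2\text{-loc}}(\rho)=F\big(\mathrm{MI}(\rho)\big)$$ for all displacement-free pure Gaussian states $\rho$ of the $m_1+m_2$ modes. -/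

import Mathlib

open MeasureTheory
open scoped ENNReal Matrix

noncomputable section

namespace GaussianModes

/-- The Hilbert space `L²(ℝ^ι; ℂ)` of a system of bosonic modes labelled by `ι`
(Schrödinger representation). -/
abbrev ModeSpace (ι : Type) [Fintype ι] : Type :=
  Lp ℂ 2 (volume : Measure (ι → ℝ))

section OneSystem

variable {ι : Type} [Fintype ι]

/-- The function `x ↦ exp (i (u · x + u · v / 2)) ψ (x + v)`, where `c = (u, v)`. -/
def weylFun (c : ι ⊕ ι → ℝ) (ψ : (ι → ℝ) → ℂ) (x : ι → ℝ) : ℂ :=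
  Complex.exp
      (Complex.I * ((∑ i, c (Sum.inl i) * x i + (∑ i, c (Sum.inl i) * c (Sum.inr i)) / 2 : ℝ) : ℂ))
    * ψ (x + c ∘ Sum.inr)

theorem memLp_weylFun (c : ι ⊕ ι → ℝ) (ψ : ModeSpace ι) :
    MemLp (weylFun c ψ) 2 (volume : Measure (ι → ℝ)) := by
  have h1 : MemLp (fun x : ι → ℝ => (ψ : (ι → ℝ) → ℂ) (x + c ∘ Sum.inr)) 2
      (volume : Measure (ι → ℝ)) :=
    (Lp.memLp ψ).comp_measurePreserving (measurePreserving_add_right volume (c ∘ Sum.inr))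
  refine (memLp_congr_norm ?_ h1.1 ?_).2 h1
  · refine AEStronglyMeasurable.mul ?_ h1.1
    exact Continuous.aestronglyMeasurable (by fun_prop)
  · refine Filter.Eventually.of_forall fun x => ?_
    rw [weylFun, norm_mul, mul_comm Complex.I, Complex.norm_exp_ofReal_mul_I, one_mul]

/-- The Weyl operator `W(c) = exp (i ∑ⱼ cⱼ Rⱼ)`, where `R = (q, p)` is the vector of quadratures:
`Sum.inl i` labels the position `qᵢ` and `Sum.inr i` the momentum `pᵢ = -i ∂ᵢ`,
with `[q_k, p_l] = i δ_{kl}`. -/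
def weyl (c : ι ⊕ ι → ℝ) (ψ : ModeSpace ι) : ModeSpace ι :=
  (memLp_weylFun c ψ).toLp (weylFun c ψ)

/-- `ψ` is the state vector of a displacement-free Gaussian state: its characteristic function is
`⟨ψ, W(c) ψ⟩ = exp (-cᵀ V c / 4)` for a real symmetric matrix `V`, the covariance matrix
`V_{jk} = ⟨R_j R_k + R_k R_j⟩` (the vacuum has `V = 1`). At `c = 0` this says `‖ψ‖ = 1`. -/
def IsPureGaussian (ψ : ModeSpace ι) : Prop :=
  ∃ V : Matrix (ι ⊕ ι) (ι ⊕ ι) ℝ, V.IsSymm ∧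
    ∀ c : ι ⊕ ι → ℝ, inner ℂ ψ (weyl c ψ) = Complex.exp ((-(c ⬝ᵥ V *ᵥ c) / 4 : ℝ) : ℂ)

variable [DecidableEq ι]

/-- `U` is a Gaussian unitary: in the Heisenberg picture it acts on the quadratures as
`U† R U = S R + d`, with `S` symplectic and `d` real, i.e. `U† W(c) U = exp (i c·d) W(Sᵀ c)`. -/
def IsGaussianUnitary (U : ModeSpace ι ≃ₗᵢ[ℂ] ModeSpace ι) : Prop :=
  ∃ S ∈ Matrix.symplecticGroup ι ℝ, ∃ d : ι ⊕ ι → ℝ, ∀ (c : ι ⊕ ι → ℝ) (φ : ModeSpace ι),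
    weyl c (U φ) = Complex.exp (Complex.I * ((c ⬝ᵥ d : ℝ) : ℂ)) • U (weyl (Sᵀ *ᵥ c) φ)

/-- `⟨ψ, R_j² ψ⟩ = ‖R_j ψ‖² ∈ [0, ∞]`. As `R_j` is the self-adjoint generator of
`t ↦ W(t e_j) = exp (i t R_j)`, this is the limit for `t → 0`, and also the supremum, of
`‖W(t e_j) ψ - ψ‖² / t²`, which is `∞` exactly when `ψ` is not in the domain of `R_j`.
(At `t = 0` the quotient is `0 / 0 = 0` and does not affect the supremum.) -/
def quadratureSq (j : ι ⊕ ι) (ψ : ModeSpace ι) : ℝ≥0∞ :=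
  ⨆ t : ℝ, ENNReal.ofReal (‖weyl (Pi.single j t) ψ - ψ‖ ^ 2 / t ^ 2)

/-- The energy `⟨ψ, H ψ⟩ ∈ [0, ∞]` for `H = ½ ∑ᵢ (qᵢ² + pᵢ²)`. -/
def energy (ψ : ModeSpace ι) : ℝ≥0∞ :=
  (∑ j, quadratureSq j ψ) / 2

/-- Global Gaussian ergotropy: the energy of the state minus the least energy that is reached by
Gaussian unitaries on all modes. -/
def globalErgotropy (ψ : ModeSpace ι) : ℝ :=
  (energy ψ).toReal -
    (⨅ U : {U : ModeSpace ι ≃ₗᵢ[ℂ] ModeSpace ι // IsGaussianUnitary U}, energy (U.1 ψ)).toReal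

end OneSystem

section Entropy

variable {E : Type} [NormedAddCommGroup E] [InnerProductSpace ℂ E]

/-- The von Neumann entropy `-Tr (ρ ln ρ) = -∑ p ln p ∈ [0, ∞]` of a density operator, where the
sum runs over the eigenvalues `p` of `ρ`, repeated according to their multiplicity. -/
def vonNeumannEntropy (ρ : E →L[ℂ] E) : ℝ≥0∞ :=
  ∑' p : ℝ, (Module.finrank ℂ (Module.End.eigenspace (ρ : E →ₗ[ℂ] E) (p : ℂ)) : ℝ≥0∞) *
    ENNReal.ofReal (Real.negMulLog p)

/-- The density operator `|ψ⟩⟨ψ|`. -/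
def pureState (ψ : E) : E →L[ℂ] E :=
  InnerProductSpace.rankOne ℂ ψ ψ

variable (E) [CompleteSpace E]

/-- The index set of some orthonormal (Hilbert) basis of `E`. -/
def onbIndex : Set E := (exists_hilbertBasis ℂ E).choose

/-- Some orthonormal (Hilbert) basis of `E`. -/
def onb : HilbertBasis (onbIndex E) ℂ E := (exists_hilbertBasis ℂ E).choose_spec.choose

end Entropy

section TwoSystems

variable {ι κ : Type} [Fintype ι] [Fintype κ]

/-- The function `(x, y) ↦ f x * g y`. -/
def tensorFun (f : (ι → ℝ) → ℂ) (g : (κ → ℝ) → ℂ) (z : ι ⊕ κ → ℝ) : ℂ :=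
  f (z ∘ Sum.inl) * g (z ∘ Sum.inr)

theorem quasi_inl : Measure.QuasiMeasurePreserving
    (fun z : ι ⊕ κ → ℝ => z ∘ Sum.inl) volume volume :=
  Measure.quasiMeasurePreserving_fst.comp
    (volume_measurePreserving_sumPiEquivProdPi (fun _ : ι ⊕ κ => ℝ)).quasiMeasurePreserving

theorem quasi_inr : Measure.QuasiMeasurePreserving
    (fun z : ι ⊕ κ → ℝ => z ∘ Sum.inr) volume volume :=
  Measure.quasiMeasurePreserving_snd.comp
    (volume_measurePreserving_sumPiEquivProdPi (fun _ : ι ⊕ κ => ℝ)).quasiMeasurePreserving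

theorem aestronglyMeasurable_tensorFun (f : ModeSpace ι) (g : ModeSpace κ) :
    AEStronglyMeasurable (tensorFun f g) (volume : Measure (ι ⊕ κ → ℝ)) :=
  ((Lp.aestronglyMeasurable f).comp_quasiMeasurePreserving quasi_inl).mul
    ((Lp.aestronglyMeasurable g).comp_quasiMeasurePreserving quasi_inr)

theorem eLpNorm_tensorFun (f : ModeSpace ι) (g : ModeSpace κ) :
    eLpNorm (tensorFun f g) 2 (volume : Measure (ι ⊕ κ → ℝ)) =
      eLpNorm f 2 volume * eLpNorm g 2 volume := by
  have h2 : (2 : ℝ≥0∞) ≠ 0 := by norm_num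
  have h2' : (2 : ℝ≥0∞) ≠ ∞ := by norm_num
  rw [eLpNorm_eq_lintegral_rpow_enorm_toReal h2 h2', eLpNorm_eq_lintegral_rpow_enorm_toReal h2 h2',
    eLpNorm_eq_lintegral_rpow_enorm_toReal h2 h2', ← ENNReal.mul_rpow_of_nonneg _ _ (by positivity)]
  congr 1
  rw [← lintegral_prod_mul ((Lp.aestronglyMeasurable f).enorm.pow_const _)
    ((Lp.aestronglyMeasurable g).enorm.pow_const _)]
  rw [← Measure.volume_eq_prod, ← (volume_measurePreserving_sumPiEquivProdPi
    (fun _ : ι ⊕ κ => ℝ)).lintegral_comp_emb (MeasurableEquiv.measurableEmbedding _)]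
  refine lintegral_congr fun z => ?_
  rw [tensorFun, enorm_mul, ENNReal.mul_rpow_of_nonneg _ _ (by positivity)]
  rfl

theorem memLp_tensorFun (f : ModeSpace ι) (g : ModeSpace κ) :
    MemLp (tensorFun f g) 2 (volume : Measure (ι ⊕ κ → ℝ)) :=
  ⟨aestronglyMeasurable_tensorFun f g, by
    rw [eLpNorm_tensorFun]
    exact ENNReal.mul_lt_top (Lp.memLp f).2 (Lp.memLp g).2⟩

/-- The product vector `f ⊗ g`, as a bounded bilinear map
`L²(ℝ^ι) × L²(ℝ^κ) → L²(ℝ^ι × ℝ^κ) = L²(ℝ^(ι ⊕ κ))`. -/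
def tensor : ModeSpace ι →L[ℂ] ModeSpace κ →L[ℂ] ModeSpace (ι ⊕ κ) :=
  LinearMap.mkContinuous₂
    (LinearMap.mk₂ ℂ (fun f g => (memLp_tensorFun f g).toLp (tensorFun f g))
      (fun f f' g => by
        rw [← MemLp.toLp_add]
        refine MemLp.toLp_congr _ _ ?_
        filter_upwards [quasi_inl.ae (Lp.coeFn_add f f')] with z hz
        simp only [tensorFun, Pi.add_apply, hz, add_mul])
      (fun a f g => by
        rw [← MemLp.toLp_const_smul]
        refine MemLp.toLp_congr _ _ ?_
        filter_upwards [quasi_inl.ae (Lp.coeFn_smul a f)] with z hz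
        simp only [tensorFun, Pi.smul_apply, hz, smul_eq_mul, mul_assoc])
      (fun f g g' => by
        rw [← MemLp.toLp_add]
        refine MemLp.toLp_congr _ _ ?_
        filter_upwards [quasi_inr.ae (Lp.coeFn_add g g')] with z hz
        simp only [tensorFun, Pi.add_apply, hz, mul_add])
      (fun a f g => by
        rw [← MemLp.toLp_const_smul]
        refine MemLp.toLp_congr _ _ ?_
        filter_upwards [quasi_inr.ae (Lp.coeFn_smul a g)] with z hz
        simp only [tensorFun, Pi.smul_apply, hz, smul_eq_mul, mul_left_comm]))
    1 (fun f g => by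
      rw [LinearMap.mk₂_apply, Lp.norm_toLp, eLpNorm_tensorFun, ENNReal.toReal_mul, one_mul]
      rfl)

/-- The reduced state on the modes `ι`: the partial trace
`∑ₖ (1 ⊗ ⟨eₖ|) ρ (1 ⊗ |eₖ⟩)` over the modes `κ`. -/
def partialTraceRight (ρ : ModeSpace (ι ⊕ κ) →L[ℂ] ModeSpace (ι ⊕ κ)) :
    ModeSpace ι →L[ℂ] ModeSpace ι :=
  ∑' k : onbIndex (ModeSpace κ),
    ContinuousLinearMap.adjoint (tensor.flip (onb (ModeSpace κ) k)) ∘L ρ ∘L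
      tensor.flip (onb (ModeSpace κ) k)

/-- The reduced state on the modes `κ`: the partial trace
`∑ₖ (⟨eₖ| ⊗ 1) ρ (|eₖ⟩ ⊗ 1)` over the modes `ι`. -/
def partialTraceLeft (ρ : ModeSpace (ι ⊕ κ) →L[ℂ] ModeSpace (ι ⊕ κ)) :
    ModeSpace κ →L[ℂ] ModeSpace κ :=
  ∑' k : onbIndex (ModeSpace ι),
    ContinuousLinearMap.adjoint (tensor (onb (ModeSpace ι) k)) ∘L ρ ∘L
      tensor (onb (ModeSpace ι) k)

/-- The mutual information `S(ρ₁) + S(ρ₂) - S(ρ)` of `ρ = |ψ⟩⟨ψ|` across the bipartition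
`ι | κ`. -/
def mutualInformation (ψ : ModeSpace (ι ⊕ κ)) : ℝ :=
  (vonNeumannEntropy (partialTraceRight (pureState ψ))).toReal +
    (vonNeumannEntropy (partialTraceLeft (pureState ψ))).toReal -
    (vonNeumannEntropy (pureState ψ)).toReal

variable [DecidableEq ι] [DecidableEq κ]

/-- `U = U₁ ⊗ U₂` with Gaussian unitaries `U₁` on the modes `ι` and `U₂` on the modes `κ`. -/
def IsLocalGaussianUnitary (U : ModeSpace (ι ⊕ κ) ≃ₗᵢ[ℂ] ModeSpace (ι ⊕ κ)) : Prop :=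
  ∃ (U₁ : ModeSpace ι ≃ₗᵢ[ℂ] ModeSpace ι) (U₂ : ModeSpace κ ≃ₗᵢ[ℂ] ModeSpace κ),
    IsGaussianUnitary U₁ ∧ IsGaussianUnitary U₂ ∧
      ∀ f g, U (tensor f g) = tensor (U₁ f) (U₂ g)

/-- `2`-local Gaussian ergotropy for the bipartition `ι | κ`: the energy of the state minus the
least energy that is reached by products of Gaussian unitaries on the two parts. -/
def localErgotropy (ψ : ModeSpace (ι ⊕ κ)) : ℝ :=
  (energy ψ).toReal -
    (⨅ U : {U : ModeSpace (ι ⊕ κ) ≃ₗᵢ[ℂ] ModeSpace (ι ⊕ κ) // IsLocalGaussianUnitary U},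
      energy (U.1 ψ)).toReal

/-- The `2`-local ergotropic gap for the bipartition `ι | κ`. -/
def ergotropicGap (ψ : ModeSpace (ι ⊕ κ)) : ℝ :=
  globalErgotropy ψ - localErgotropy ψ

end TwoSystems

end GaussianModes

end

noncomputable section

namespace GaussianModes

section Spectrum

variable {E : Type} [NormedAddCommGroup E] [InnerProductSpace ℂ E]

/-- An operator that acts as `∑ₙ pₙ |eₙ⟩⟨eₙ|`, for an orthonormal family `e`, in weak form. -/
def IsDiagonalOn {α : Type*} (e : α → E) (p : α → ℝ) (ρ : E →L[ℂ] E) : Prop :=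
  ∀ x g : E, HasSum (fun n => (p n : ℂ) * (inner ℂ (e n) g * inner ℂ x (e n))) (inner ℂ x (ρ g))

variable {α : Type*} {e : α → E} {p : α → ℝ} {ρ : E →L[ℂ] E}

theorem IsDiagonalOn.apply_basis (he : Orthonormal ℂ e) (h : IsDiagonalOn e p ρ) (m : α) :
    ρ (e m) = (p m : ℂ) • e m := by
  classical
  refine ext_inner_left ℂ fun x => ?_
  refine (h x (e m)).unique ?_
  rw [inner_smul_right]
  convert hasSum_ite_eq m ((p m : ℂ) * inner ℂ x (e m)) using 2 with n
  rw [orthonormal_iff_ite.1 he]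
  split_ifs with hn <;> simp [hn]

theorem IsDiagonalOn.apply_eq_zero (h : IsDiagonalOn e p ρ) {g : E}
    (hg : ∀ n, p n ≠ 0 → inner ℂ (e n) g = 0) : ρ g = 0 := by
  refine ext_inner_left ℂ fun x => ?_
  refine (h x g).unique ?_
  rw [inner_zero_right]
  convert (hasSum_zero : HasSum (fun _ : α => (0 : ℂ)) 0) using 2 with n
  by_cases hp : p n = 0
  · simp [hp]
  · simp [hg n hp]

theorem IsDiagonalOn.inner_basis (he : Orthonormal ℂ e) (h : IsDiagonalOn e p ρ) (n : α) (g : E) :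
    inner ℂ (e n) (ρ g) = (p n : ℂ) * inner ℂ (e n) g := by
  classical
  refine (h (e n) g).unique ?_
  convert hasSum_ite_eq n ((p n : ℂ) * inner ℂ (e n) g) using 2 with m
  rw [orthonormal_iff_ite.1 he]
  by_cases hn : n = m
  · subst hn; simp
  · rw [if_neg hn, if_neg (fun h => hn h.symm)]; simp

theorem IsDiagonalOn.eigenspace_eq_span (he : Orthonormal ℂ e) (h : IsDiagonalOn e p ρ) {q : ℝ}
    (hq : q ≠ 0) (hfin : {n | p n = q}.Finite) :
    Module.End.eigenspace (ρ : E →ₗ[ℂ] E) (q : ℂ) =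
      Submodule.span ℂ (Set.range fun n : {n | p n = q} => e n) := by
  classical
  apply le_antisymm
  · intro g hg
    have hg' : ρ g = (q : ℂ) • g := Module.End.mem_eigenspace_iff.1 hg
    set g' : E := g - ∑ n ∈ hfin.toFinset, inner ℂ (e n) g • e n with hg'def
    have hcoef : ∀ n, p n ≠ q → inner ℂ (e n) g = 0 := by
      intro n hn
      have h1 := h.inner_basis he n g
      rw [hg', inner_smul_right] at h1
      have h2 : ((q - p n : ℝ) : ℂ) * inner ℂ (e n) g = 0 := by
        push_cast; linear_combination h1
      rcases mul_eq_zero.1 h2 with h3 | h3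
      · exact absurd (sub_eq_zero.1 (Complex.ofReal_eq_zero.1 h3)).symm hn
      · exact h3
    have horth : ∀ n, inner ℂ (e n) g' = 0 := by
      intro n
      rw [hg'def, inner_sub_right, inner_sum]
      simp only [inner_smul_right, orthonormal_iff_ite.1 he, mul_ite, mul_one, mul_zero]
      rw [Finset.sum_ite_eq]
      split_ifs with hn
      · simp
      · rw [hcoef n (by simpa using hn)]; simp
    have h0 : ρ g' = 0 := h.apply_eq_zero fun n _ => horth n
    have h1 : ρ g' = (q : ℂ) • g' := by
      rw [hg'def, map_sub, map_sum, hg', smul_sub, Finset.smul_sum]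
      congr 1
      refine Finset.sum_congr rfl fun n hn => ?_
      rw [map_smul, h.apply_basis he, smul_comm, show p n = q by simpa using hn]
    rw [h0] at h1
    have h2 : g' = 0 := by
      rcases smul_eq_zero.1 h1.symm with h3 | h3
      · exact absurd (Complex.ofReal_eq_zero.1 h3) hq
      · exact h3
    rw [sub_eq_zero.1 h2]
    refine Submodule.sum_mem _ fun n hn => Submodule.smul_mem _ _ (Submodule.subset_span ?_)
    exact ⟨⟨n, by simpa using hn⟩, rfl⟩
  · rw [Submodule.span_le]
    rintro _ ⟨⟨n, hn⟩, rfl⟩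
    have hn' : p n = q := hn
    refine Module.End.mem_eigenspace_iff.2 ?_
    change ρ (e n) = _
    rw [h.apply_basis he, hn']

theorem IsDiagonalOn.finrank_eigenspace (he : Orthonormal ℂ e) (h : IsDiagonalOn e p ρ) {q : ℝ}
    (hq : q ≠ 0) (hfin : {n | p n = q}.Finite) :
    (Module.finrank ℂ (Module.End.eigenspace (ρ : E →ₗ[ℂ] E) (q : ℂ)) : ℝ≥0∞) =
      ∑' _ : {n | p n = q}, 1 := by
  have : Fintype {n | p n = q} := hfin.fintype
  have hli : LinearIndependent ℂ fun n : {n | p n = q} => e n :=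
    he.linearIndependent.comp _ Subtype.val_injective
  rw [h.eigenspace_eq_span he hq hfin, finrank_span_eq_card hli, tsum_fintype]
  simp

/-- The von Neumann entropy of a diagonal density operator is the Shannon entropy of its
diagonal. -/
theorem IsDiagonalOn.vonNeumannEntropy_eq (he : Orthonormal ℂ e) (h : IsDiagonalOn e p ρ)
    (hp : Summable p) :
    vonNeumannEntropy ρ = ∑' n, ENNReal.ofReal (Real.negMulLog (p n)) := by
  rw [vonNeumannEntropy, ← ENNReal.tsum_fiberwise _ p]
  refine tsum_congr fun q => ?_
  have hr : ∑' x : (p ⁻¹' {q} : Set α), ENNReal.ofReal (Real.negMulLog (p x)) =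
      (∑' _ : {n | p n = q}, 1) * ENNReal.ofReal (Real.negMulLog q) := by
    rw [← ENNReal.tsum_mul_right]
    refine tsum_congr fun x => ?_
    rw [one_mul, show p x = q from x.2]
  rw [hr]
  by_cases hq : q = 0
  · simp [hq]
  · rw [h.finrank_eigenspace he hq]
    have h1 : ∀ᶠ n in Filter.cofinite, p n ≠ q :=
      hp.tendsto_cofinite_zero.eventually_ne (Ne.symm hq)
    simpa [Filter.eventually_cofinite] using h1

theorem isDiagonalOn_pureState (ψ : E) : IsDiagonalOn (fun _ : Unit => ψ) (fun _ => 1)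
    (pureState ψ) := by
  intro x g
  simp [pureState]

theorem vonNeumannEntropy_pureState {ψ : E} (hψ : ‖ψ‖ = 1) :
    vonNeumannEntropy (pureState ψ) = 0 := by
  rw [(isDiagonalOn_pureState ψ).vonNeumannEntropy_eq ?_ (hasSum_fintype _).summable]
  · simp
  · exact ⟨fun _ => hψ, fun i j hij => absurd (Subsingleton.elim i j) hij⟩

end Spectrum

section PartialTrace

variable {E F G β : Type} [NormedAddCommGroup E] [InnerProductSpace ℂ E] [CompleteSpace E]
  [NormedAddCommGroup F] [InnerProductSpace ℂ F]
  [NormedAddCommGroup G] [InnerProductSpace ℂ G] [CompleteSpace G]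
  {B : E →L[ℂ] F →L[ℂ] G}

open ContinuousLinearMap in
theorem sum_norm_sq_adjoint_le (hB : ∀ f f' g g', inner ℂ (B f g) (B f' g') =
      inner ℂ f f' * inner ℂ g g') {b : β → F} (hb : Orthonormal ℂ b) (ψ : G) (s : Finset β) :
    ∑ k ∈ s, ‖adjoint (B.flip (b k)) ψ‖ ^ 2 ≤ ‖ψ‖ ^ 2 := by
  classical
  set v : β → E := fun k => adjoint (B.flip (b k)) ψ
  set φ : G := ∑ k ∈ s, B (v k) (b k)
  set S : ℝ := ∑ k ∈ s, ‖v k‖ ^ 2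
  have h1 : inner ℂ φ ψ = (S : ℂ) := by
    simp only [φ, S, sum_inner]
    push_cast
    refine Finset.sum_congr rfl fun k _ => ?_
    change inner ℂ (B.flip (b k) (v k)) ψ = _
    rw [← adjoint_inner_right]
    exact inner_self_eq_norm_sq_to_K (𝕜 := ℂ) (v k)
  have h2 : inner ℂ φ φ = (S : ℂ) := by
    simp only [φ, S, sum_inner, inner_sum]
    push_cast
    refine Finset.sum_congr rfl fun k hk => ?_
    simp only [hB, orthonormal_iff_ite.1 hb, mul_ite, mul_one, mul_zero]
    rw [Finset.sum_ite_eq', if_pos hk, inner_self_eq_norm_sq_to_K]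
    simp
  have h3 : ‖φ‖ ^ 2 = S := by
    have h3 : ((‖φ‖ : ℂ)) ^ 2 = (S : ℂ) := (inner_self_eq_norm_sq_to_K (𝕜 := ℂ) φ).symm.trans h2
    exact_mod_cast h3
  have h4 : S ≤ ‖φ‖ * ‖ψ‖ := by
    have := norm_inner_le_norm (𝕜 := ℂ) φ ψ
    rw [h1, Complex.norm_real] at this
    exact (le_abs_self S).trans this
  change S ≤ _
  nlinarith [sq_nonneg (‖φ‖ - ‖ψ‖), norm_nonneg φ, norm_nonneg ψ]

/-- The partial trace of a pure state with Schmidt decomposition `ψ = ∑ₙ sₙ eₙ ⊗ fₙ`. -/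
theorem isDiagonalOn_partialTrace [CompleteSpace F] {α : Type*}
    (hB : ∀ f f' g g', inner ℂ (B f g) (B f' g') =
      inner ℂ f f' * inner ℂ g g') (b : HilbertBasis β ℂ F) {ψ : G} {e : α → E} {f : α → F}
    {s : α → ℝ} (hf : Orthonormal ℂ f) (hψ : HasSum (fun n => (s n : ℂ) • B (e n) (f n)) ψ) :
    IsDiagonalOn e (fun n => s n ^ 2)
      (∑' k : β, ContinuousLinearMap.adjoint (B.flip (b k)) ∘L pureState ψ ∘L B.flip (b k)) := by
  classical
  intro x g
  have hterm : ∀ k, ContinuousLinearMap.adjoint (B.flip (b k)) ∘L pureState ψ ∘L B.flip (b k) =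
      InnerProductSpace.rankOne ℂ (ContinuousLinearMap.adjoint (B.flip (b k)) ψ)
        (ContinuousLinearMap.adjoint (B.flip (b k)) ψ) := fun k => by
    rw [pureState, InnerProductSpace.rankOne_comp, InnerProductSpace.comp_rankOne]
  have hsum : Summable fun k => ContinuousLinearMap.adjoint (B.flip (b k)) ∘L pureState ψ ∘L
      B.flip (b k) := by
    refine Summable.of_norm ?_
    simp only [hterm, InnerProductSpace.norm_rankOne, ← sq]
    exact summable_of_sum_le (fun _ => sq_nonneg _) (sum_norm_sq_adjoint_le hB b.orthonormal ψ)
  set w : E → F := fun y => ContinuousLinearMap.adjoint (B y) ψ with hw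
  have hval : inner ℂ x ((∑' k : β, ContinuousLinearMap.adjoint (B.flip (b k)) ∘L pureState ψ ∘L
      B.flip (b k)) g) = inner ℂ (w g) (w x) := by
    have h1 := (hsum.hasSum.mapL (ContinuousLinearMap.apply ℂ E g)).mapL (innerSL ℂ x)
    refine h1.unique ?_
    convert b.hasSum_inner_mul_inner (w g) (w x) using 2 with k
    simp only [hw, ContinuousLinearMap.adjoint_inner_left, ContinuousLinearMap.adjoint_inner_right,
      hterm, ContinuousLinearMap.apply_apply, InnerProductSpace.rankOne_apply,
      innerSL_apply_apply, inner_smul_right, ContinuousLinearMap.flip_apply]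
  have hws : ∀ y, HasSum (fun n => ((s n : ℂ) * inner ℂ y (e n)) • f n) (w y) := by
    intro y
    convert hψ.mapL (ContinuousLinearMap.adjoint (B y)) using 2 with n
    refine ext_inner_left ℂ fun z => ?_
    rw [map_smul, inner_smul_right, inner_smul_right, ContinuousLinearMap.adjoint_inner_right, hB]
    ring
  have hwf : ∀ y m, inner ℂ (w y) (f m) = (s m : ℂ) * inner ℂ (e m) y := by
    intro y m
    rw [← inner_conj_symm]
    have h1 := (hws y).mapL (innerSL ℂ (f m))
    have h2 : HasSum (fun n => innerSL ℂ (f m) (((s n : ℂ) * inner ℂ y (e n)) • f n))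
        ((s m : ℂ) * inner ℂ y (e m)) := by
      convert hasSum_ite_eq m ((s m : ℂ) * inner ℂ y (e m)) using 2 with n
      rw [innerSL_apply_apply, inner_smul_right, orthonormal_iff_ite.1 hf]
      by_cases hn : m = n
      · subst hn; simp
      · rw [if_neg hn, if_neg (fun h => hn h.symm)]; simp
    rw [show inner ℂ (f m) (w y) = _ from h1.unique h2]
    simp
  rw [hval]
  have h1 := (hws x).mapL (innerSL ℂ (w g))
  simp only [innerSL_apply_apply, inner_smul_right, hwf] at h1
  refine h1.congr_fun fun n => ?_
  push_cast
  ring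

end PartialTrace

section Weyl

variable {ι : Type} [Fintype ι]

theorem coeFn_weyl (c : ι ⊕ ι → ℝ) (ψ : ModeSpace ι) :
    (weyl c ψ : (ι → ℝ) → ℂ) =ᵐ[volume] weylFun c ψ :=
  MemLp.coeFn_toLp _

theorem quasiMeasurePreserving_add_right (v : ι → ℝ) :
    Measure.QuasiMeasurePreserving (fun x : ι → ℝ => x + v) volume volume :=
  (measurePreserving_add_right volume v).quasiMeasurePreserving

theorem weyl_add (c : ι ⊕ ι → ℝ) (φ ψ : ModeSpace ι) : weyl c (φ + ψ) = weyl c φ + weyl c ψ := by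
  refine Lp.ext ?_
  filter_upwards [coeFn_weyl c (φ + ψ), coeFn_weyl c φ, coeFn_weyl c ψ,
    Lp.coeFn_add (weyl c φ) (weyl c ψ),
    (quasiMeasurePreserving_add_right (c ∘ Sum.inr)).ae (Lp.coeFn_add φ ψ)] with x h1 h2 h3 h4 h5
  rw [h1, h4, Pi.add_apply, h2, h3, weylFun, weylFun, weylFun, h5, Pi.add_apply, mul_add]

theorem weyl_smul (c : ι ⊕ ι → ℝ) (a : ℂ) (ψ : ModeSpace ι) : weyl c (a • ψ) = a • weyl c ψ := by
  refine Lp.ext ?_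
  filter_upwards [coeFn_weyl c (a • ψ), coeFn_weyl c ψ, Lp.coeFn_smul a (weyl c ψ),
    (quasiMeasurePreserving_add_right (c ∘ Sum.inr)).ae (Lp.coeFn_smul a ψ)] with x h1 h2 h3 h4
  rw [h1, h3, Pi.smul_apply, h2, weylFun, weylFun, h4, Pi.smul_apply, smul_eq_mul, smul_eq_mul,
    mul_left_comm]

theorem norm_weyl (c : ι ⊕ ι → ℝ) (ψ : ModeSpace ι) : ‖weyl c ψ‖ = ‖ψ‖ := by
  rw [weyl, Lp.norm_toLp, Lp.norm_def]
  congr 1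
  rw [← eLpNorm_comp_measurePreserving (Lp.aestronglyMeasurable ψ)
    (measurePreserving_add_right volume (c ∘ Sum.inr))]
  refine eLpNorm_congr_norm_ae (Filter.Eventually.of_forall fun x => ?_)
  rw [weylFun, norm_mul, mul_comm Complex.I, Complex.norm_exp_ofReal_mul_I, one_mul]
  rfl

/-- The Weyl operator as a linear isometry. -/
def weylₗᵢ (c : ι ⊕ ι → ℝ) : ModeSpace ι →ₗᵢ[ℂ] ModeSpace ι where
  toFun := weyl c
  map_add' := weyl_add c
  map_smul' := weyl_smul c
  norm_map' := norm_weyl c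

theorem norm_weyl_sub_sq (c : ι ⊕ ι → ℝ) {ψ : ModeSpace ι} (hψ : ‖ψ‖ = 1) :
    ‖weyl c ψ - ψ‖ ^ 2 = 2 - 2 * (inner ℂ ψ (weyl c ψ)).re := by
  rw [@norm_sub_sq ℂ, norm_weyl, hψ, inner_re_symm]
  simp
  ring

end Weyl

section Tensor

variable {ι κ : Type} [Fintype ι] [Fintype κ]

theorem coeFn_tensor (f : ModeSpace ι) (g : ModeSpace κ) :
    (tensor f g : (ι ⊕ κ → ℝ) → ℂ) =ᵐ[volume] tensorFun f g :=
  MemLp.coeFn_toLp (memLp_tensorFun f g)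

theorem integral_sum_pi {f : (ι ⊕ κ → ℝ) → ℂ} :
    ∫ z, f z = ∫ w : (ι → ℝ) × (κ → ℝ), f (Sum.elim w.1 w.2) := by
  rw [← (volume_measurePreserving_sumPiEquivProdPi_symm (fun _ : ι ⊕ κ => ℝ)).integral_comp
    (MeasurableEquiv.measurableEmbedding _)]
  refine integral_congr_ae (Filter.Eventually.of_forall fun w => ?_)
  change f _ = f _
  congr 1

theorem integral_tensorFun (f : (ι → ℝ) → ℂ) (g : (κ → ℝ) → ℂ) :
    ∫ z, tensorFun f g z = (∫ x, f x) * ∫ y, g y := by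
  rw [integral_sum_pi, ← integral_prod_mul]
  rfl

theorem inner_tensor (f f' : ModeSpace ι) (g g' : ModeSpace κ) :
    inner ℂ (tensor f g) (tensor f' g') = inner ℂ f f' * inner ℂ g g' := by
  rw [L2.inner_def, L2.inner_def, L2.inner_def, ← integral_tensorFun]
  refine integral_congr_ae ?_
  filter_upwards [coeFn_tensor f g, coeFn_tensor f' g'] with z h1 h2
  rw [h1, h2]
  simp only [tensorFun, RCLike.inner_apply, map_mul]
  ring

/-- The restriction of a phase space vector to the modes `ι`. -/
def resInl (c : (ι ⊕ κ) ⊕ (ι ⊕ κ) → ℝ) : ι ⊕ ι → ℝ := c ∘ Sum.map Sum.inl Sum.inl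

/-- The restriction of a phase space vector to the modes `κ`. -/
def resInr (c : (ι ⊕ κ) ⊕ (ι ⊕ κ) → ℝ) : κ ⊕ κ → ℝ := c ∘ Sum.map Sum.inr Sum.inr

/-- The phase space vector with the given restrictions to `ι` and `κ`. -/
def joinPhase (a : ι ⊕ ι → ℝ) (b : κ ⊕ κ → ℝ) : (ι ⊕ κ) ⊕ (ι ⊕ κ) → ℝ :=
  Sum.elim (Sum.elim (a ∘ Sum.inl) (b ∘ Sum.inl)) (Sum.elim (a ∘ Sum.inr) (b ∘ Sum.inr))

theorem weyl_tensor (c : (ι ⊕ κ) ⊕ (ι ⊕ κ) → ℝ) (f : ModeSpace ι) (g : ModeSpace κ) :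
    weyl c (tensor f g) = tensor (weyl (resInl c) f) (weyl (resInr c) g) := by
  refine Lp.ext ?_
  filter_upwards [coeFn_weyl c (tensor f g), coeFn_tensor (weyl (resInl c) f) (weyl (resInr c) g),
    quasi_inl.ae (coeFn_weyl (resInl c) f), quasi_inr.ae (coeFn_weyl (resInr c) g),
    (quasiMeasurePreserving_add_right (c ∘ Sum.inr)).ae (coeFn_tensor f g)] with z h1 h2 h3 h4 h5
  rw [h1, h2, weylFun, h5, tensorFun, tensorFun, h3, h4, weylFun, weylFun]
  have hexp : ∀ a b a' b' s : ℂ, s = a + a' → Complex.exp (Complex.I * s) * (b * b') =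
      Complex.exp (Complex.I * a) * b * (Complex.exp (Complex.I * a') * b') := by
    rintro a b a' b' s rfl
    rw [mul_add, Complex.exp_add]
    ring
  refine hexp _ _ _ _ _ ?_
  rw [← Complex.ofReal_add]
  congr 1
  simp only [Fintype.sum_sum_type, resInl, resInr, Function.comp_apply, Sum.map_inl, Sum.map_inr]
  ring

end Tensor

section GaussianUnitary

variable {ι : Type} [Fintype ι] [DecidableEq ι]

theorem IsGaussianUnitary.refl : IsGaussianUnitary (LinearIsometryEquiv.refl ℂ (ModeSpace ι)) := by
  refine ⟨1, Submonoid.one_mem _, 0, fun c φ => ?_⟩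
  simp

theorem IsGaussianUnitary.trans {U W : ModeSpace ι ≃ₗᵢ[ℂ] ModeSpace ι} (hW : IsGaussianUnitary W)
    (hU : IsGaussianUnitary U) : IsGaussianUnitary (W.trans U) := by
  obtain ⟨S, hS, d, h⟩ := hU
  obtain ⟨S', hS', d', h'⟩ := hW
  refine ⟨S * S', Submonoid.mul_mem _ hS hS', d + S *ᵥ d', fun c φ => ?_⟩
  rw [LinearIsometryEquiv.trans_apply, h, h', map_smul, smul_smul, ← Complex.exp_add,
    LinearIsometryEquiv.trans_apply, Matrix.mulVec_mulVec, Matrix.transpose_mul]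
  congr 2
  rw [← mul_add, ← Complex.ofReal_add, dotProduct_add]
  congr 3
  rw [Matrix.dotProduct_mulVec, Matrix.mulVec_transpose]

/-- The least energy in the orbit of a state under Gaussian unitaries depends only on the orbit. -/
theorem iInf_energy_orbit {W : ModeSpace ι ≃ₗᵢ[ℂ] ModeSpace ι} (hW : IsGaussianUnitary W)
    (hW' : IsGaussianUnitary W.symm) (ψ : ModeSpace ι) :
    ⨅ U : {U : ModeSpace ι ≃ₗᵢ[ℂ] ModeSpace ι // IsGaussianUnitary U}, energy (U.1 (W ψ)) =
      ⨅ U : {U : ModeSpace ι ≃ₗᵢ[ℂ] ModeSpace ι // IsGaussianUnitary U}, energy (U.1 ψ) := by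
  apply le_antisymm
  · refine le_iInf fun U => ?_
    refine (iInf_le (fun U : {U : ModeSpace ι ≃ₗᵢ[ℂ] ModeSpace ι // IsGaussianUnitary U} =>
      energy (U.1 (W ψ))) ⟨W.symm.trans U.1, hW'.trans U.2⟩).trans_eq ?_
    change energy (U.1 (W.symm (W ψ))) = _
    rw [W.symm_apply_apply]
  · refine le_iInf fun U => ?_
    exact iInf_le (fun U : {U : ModeSpace ι ≃ₗᵢ[ℂ] ModeSpace ι // IsGaussianUnitary U} =>
      energy (U.1 ψ)) ⟨W.trans U.1, hW.trans U.2⟩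

/-- `f ↦ f ∘ M` for a volume preserving matrix `M` with inverse `M'`. -/
def pullback (M M' : Matrix ι ι ℝ) (h : M * M' = 1)
    (hM : MeasurePreserving (fun x : ι → ℝ => M *ᵥ x) volume volume)
    (hM' : MeasurePreserving (fun x : ι → ℝ => M' *ᵥ x) volume volume) :
    ModeSpace ι ≃ₗᵢ[ℂ] ModeSpace ι where
  toLinearEquiv := LinearEquiv.ofLinearMap (Lp.compMeasurePreservingₗ ℂ _ hM)
    (Lp.compMeasurePreservingₗ ℂ _ hM')
    (by
      refine LinearMap.ext fun f => Lp.ext ?_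
      have h' := mul_eq_one_comm.1 h
      filter_upwards [Lp.coeFn_compMeasurePreserving (Lp.compMeasurePreserving _ hM' f) hM,
        hM.quasiMeasurePreserving.ae (Lp.coeFn_compMeasurePreserving f hM')] with x h1 h2
      change (Lp.compMeasurePreserving _ hM (Lp.compMeasurePreserving _ hM' f)) x = f x
      rw [h1, Function.comp_apply, h2, Function.comp_apply, Matrix.mulVec_mulVec, h',
        Matrix.one_mulVec])
    (by
      refine LinearMap.ext fun f => Lp.ext ?_
      filter_upwards [Lp.coeFn_compMeasurePreserving (Lp.compMeasurePreserving _ hM f) hM',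
        hM'.quasiMeasurePreserving.ae (Lp.coeFn_compMeasurePreserving f hM)] with x h1 h2
      change (Lp.compMeasurePreserving _ hM' (Lp.compMeasurePreserving _ hM f)) x = f x
      rw [h1, Function.comp_apply, h2, Function.comp_apply, Matrix.mulVec_mulVec, h,
        Matrix.one_mulVec])
  norm_map' f := Lp.norm_compMeasurePreserving f hM

variable {M M' : Matrix ι ι ℝ} (h : M * M' = 1)
    (hM : MeasurePreserving (fun x : ι → ℝ => M *ᵥ x) volume volume)
    (hM' : MeasurePreserving (fun x : ι → ℝ => M' *ᵥ x) volume volume)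

theorem coeFn_pullback (f : ModeSpace ι) :
    (pullback M M' h hM hM' f : (ι → ℝ) → ℂ) =ᵐ[volume] fun x => f (M *ᵥ x) :=
  Lp.coeFn_compMeasurePreserving f hM

theorem pullback_symm :
    (pullback M M' h hM hM').symm = pullback M' M (mul_eq_one_comm.1 h) hM' hM := rfl

theorem weyl_pullback (c : ι ⊕ ι → ℝ) (φ : ModeSpace ι) :
    weyl c (pullback M M' h hM hM' φ) =
      pullback M M' h hM hM' (weyl ((Matrix.fromBlocks M' 0 0 Mᵀ)ᵀ *ᵥ c) φ) := by
  have hc : (Matrix.fromBlocks M' 0 0 Mᵀ)ᵀ *ᵥ c =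
      Sum.elim (M'ᵀ *ᵥ (c ∘ Sum.inl)) (M *ᵥ (c ∘ Sum.inr)) := by
    rw [Matrix.fromBlocks_transpose, Matrix.fromBlocks_mulVec]
    simp
  have h' := mul_eq_one_comm.1 h
  have hdot : ∀ x : ι → ℝ, ∑ i, (M'ᵀ *ᵥ (c ∘ Sum.inl)) i * (M *ᵥ x) i =
      ∑ i, c (Sum.inl i) * x i := by
    intro x
    change (M'ᵀ *ᵥ (c ∘ Sum.inl)) ⬝ᵥ (M *ᵥ x) = (c ∘ Sum.inl) ⬝ᵥ x
    rw [Matrix.mulVec_transpose, ← Matrix.dotProduct_mulVec, Matrix.mulVec_mulVec, h',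
      Matrix.one_mulVec]
  refine Lp.ext ?_
  filter_upwards [coeFn_weyl c (pullback M M' h hM hM' φ),
    coeFn_pullback h hM hM' (weyl ((Matrix.fromBlocks M' 0 0 Mᵀ)ᵀ *ᵥ c) φ),
    hM.quasiMeasurePreserving.ae (coeFn_weyl ((Matrix.fromBlocks M' 0 0 Mᵀ)ᵀ *ᵥ c) φ),
    (quasiMeasurePreserving_add_right (c ∘ Sum.inr)).ae (coeFn_pullback h hM hM' φ)]
    with x h1 h2 h3 h4
  rw [h1, h2, h3, weylFun, weylFun, h4, hc]
  simp only [Sum.elim_inl, Sum.elim_inr, Sum.elim_comp_inr]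
  rw [hdot, Matrix.mulVec_add]
  have := hdot (c ∘ Sum.inr)
  rw [this]
  rfl

theorem isGaussianUnitary_pullback : IsGaussianUnitary (pullback M M' h hM hM') := by
  refine ⟨Matrix.fromBlocks M' 0 0 Mᵀ, ?_, 0, fun c φ => ?_⟩
  · have h' := mul_eq_one_comm.1 h
    rw [SymplecticGroup.mem_iff, Matrix.J, Matrix.fromBlocks_transpose,
      Matrix.fromBlocks_multiply, Matrix.fromBlocks_multiply]
    simp [h', ← Matrix.transpose_mul]
  · rw [weyl_pullback]
    simp

end GaussianUnitary

section LocalUnitary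

variable {ι κ : Type} [Fintype ι] [Fintype κ] [DecidableEq ι] [DecidableEq κ]

theorem IsLocalGaussianUnitary.refl :
    IsLocalGaussianUnitary (LinearIsometryEquiv.refl ℂ (ModeSpace (ι ⊕ κ))) :=
  ⟨.refl ℂ _, .refl ℂ _, .refl, .refl, fun _ _ => rfl⟩

/-- A product of Gaussian unitaries acts on the Weyl operators by a product of symplectic maps, on
every vector with a Schmidt decomposition. -/
theorem IsLocalGaussianUnitary.exists_weyl {α : Type*}
    {U : ModeSpace (ι ⊕ κ) ≃ₗᵢ[ℂ] ModeSpace (ι ⊕ κ)} (hU : IsLocalGaussianUnitary U) :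
    ∃ S₁ ∈ Matrix.symplecticGroup ι ℝ, ∃ S₂ ∈ Matrix.symplecticGroup κ ℝ,
      ∃ θ : ((ι ⊕ κ) ⊕ (ι ⊕ κ) → ℝ) → ℝ,
      ∀ (c : (ι ⊕ κ) ⊕ (ι ⊕ κ) → ℝ) (ψ : ModeSpace (ι ⊕ κ)) (s : α → ℂ) (e : α → ModeSpace ι)
        (f : α → ModeSpace κ), HasSum (fun n => s n • tensor (e n) (f n)) ψ →
        weyl c (U ψ) = Complex.exp (Complex.I * (θ c : ℂ)) •
          U (weyl (joinPhase (S₁ᵀ *ᵥ resInl c) (S₂ᵀ *ᵥ resInr c)) ψ) := by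
  obtain ⟨U₁, U₂, ⟨S₁, hS₁, d₁, h₁⟩, ⟨S₂, hS₂, d₂, h₂⟩, hU⟩ := hU
  refine ⟨S₁, hS₁, S₂, hS₂, fun c => resInl c ⬝ᵥ d₁ + resInr c ⬝ᵥ d₂, fun c ψ s e f hψ => ?_⟩
  have hL := hψ.mapL ((weylₗᵢ c).toContinuousLinearMap ∘L
    (U.toContinuousLinearEquiv : ModeSpace (ι ⊕ κ) →L[ℂ] ModeSpace (ι ⊕ κ)))
  have hR := hψ.mapL (Complex.exp (Complex.I * ((resInl c ⬝ᵥ d₁ + resInr c ⬝ᵥ d₂ : ℝ) : ℂ)) •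
    ((U.toContinuousLinearEquiv : ModeSpace (ι ⊕ κ) →L[ℂ] ModeSpace (ι ⊕ κ)) ∘L
      (weylₗᵢ (joinPhase (S₁ᵀ *ᵥ resInl c) (S₂ᵀ *ᵥ resInr c))).toContinuousLinearMap))
  refine hL.unique ?_
  refine hR.congr_fun fun n => ?_
  simp only [map_smul]
  congr 1
  change weyl c (U (tensor (e n) (f n))) = Complex.exp _ • U (weyl _ (tensor (e n) (f n)))
  rw [hU, weyl_tensor, weyl_tensor, hU, h₁, h₂, map_smul, map_smul]
  rw [smul_apply]
  simp only [smul_smul, ← Complex.exp_add]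
  congr 2
  push_cast
  ring

end LocalUnitary

section Hermite

open Polynomial

theorem derivative_hermite_succ (n : ℕ) :
    derivative (hermite (n + 1)) = (n + 1 : ℤ[X]) * hermite n := by
  induction n with
  | zero => simp
  | succ n ih =>
    rw [hermite_succ (n + 1), derivative_sub, derivative_mul, ih, derivative_X, derivative_mul,
      show (n + 1 : ℤ[X]) = ((n + 1 : ℕ) : ℤ[X]) by push_cast; rfl, derivative_natCast,
      hermite_succ n]
    push_cast
    ring

/-- The Hermite polynomial with real coefficients. -/
def hermiteR (n : ℕ) : ℝ[X] := (hermite n).map (Int.castRingHom ℝ)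

theorem hermiteR_zero : hermiteR 0 = 1 := by simp [hermiteR]

theorem hermiteR_succ (n : ℕ) : hermiteR (n + 1) = X * hermiteR n - derivative (hermiteR n) := by
  simp [hermiteR, hermite_succ, derivative_map]

theorem derivative_hermiteR_succ (n : ℕ) :
    derivative (hermiteR (n + 1)) = (n + 1 : ℝ[X]) * hermiteR n := by
  rw [hermiteR, derivative_map, derivative_hermite_succ]
  simp [hermiteR]

theorem integrable_eval_mul_gaussian (p : ℝ[X]) :
    Integrable fun x : ℝ => p.eval x * Real.exp (-(x ^ 2 / 2)) := by
  induction p using Polynomial.induction_on' with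
  | add p q hp hq =>
    refine (hp.add hq).congr (Filter.Eventually.of_forall fun x => ?_)
    simp [add_mul]
  | monomial n a =>
    have h := (integrable_rpow_mul_exp_neg_mul_sq (b := 1 / 2) (by norm_num) (s := n)
      (by linarith [(Nat.cast_nonneg n : (0 : ℝ) ≤ n)])).const_mul a
    refine h.congr (Filter.Eventually.of_forall fun x => ?_)
    simp only [Real.rpow_natCast, eval_monomial]
    rw [mul_assoc]
    ring_nf

/-- Gaussian integration by parts. -/
theorem integral_mul_gaussian_eq_derivative (p : ℝ[X]) :
    ∫ x : ℝ, (X * p).eval x * Real.exp (-(x ^ 2 / 2)) =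
      ∫ x : ℝ, (derivative p).eval x * Real.exp (-(x ^ 2 / 2)) := by
  have hd : ∀ x : ℝ, HasDerivAt (fun x : ℝ => p.eval x * Real.exp (-(x ^ 2 / 2)))
      ((derivative p - X * p).eval x * Real.exp (-(x ^ 2 / 2))) x := by
    intro x
    have h1 : HasDerivAt (fun x : ℝ => Real.exp (-(x ^ 2 / 2)))
        (Real.exp (-(x ^ 2 / 2)) * (-x)) x := by
      refine HasDerivAt.exp ?_
      refine ((hasDerivAt_pow 2 x).div_const 2).neg.congr_deriv ?_
      norm_num
    refine ((p.hasDerivAt x).mul h1).congr_deriv ?_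
    rw [Polynomial.eval_sub, Polynomial.eval_mul, Polynomial.eval_X]
    ring
  have h0 := integral_eq_zero_of_hasDerivAt_of_integrable hd (integrable_eval_mul_gaussian _)
    (integrable_eval_mul_gaussian p)
  simp only [eval_sub, sub_mul] at h0
  rw [integral_sub (integrable_eval_mul_gaussian _) (integrable_eval_mul_gaussian _)] at h0
  linarith

theorem integral_hermiteR_succ_mul (n : ℕ) (p : ℝ[X]) :
    ∫ x : ℝ, (hermiteR (n + 1) * p).eval x * Real.exp (-(x ^ 2 / 2)) =
      ∫ x : ℝ, (hermiteR n * derivative p).eval x * Real.exp (-(x ^ 2 / 2)) := by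
  have h : hermiteR (n + 1) * p = X * (hermiteR n * p) - derivative (hermiteR n) * p := by
    rw [hermiteR_succ]; ring
  have h' : hermiteR n * derivative p =
      derivative (hermiteR n * p) - derivative (hermiteR n) * p := by
    rw [derivative_mul]; ring
  rw [h, h']
  simp only [eval_sub, sub_mul]
  rw [integral_sub (integrable_eval_mul_gaussian _) (integrable_eval_mul_gaussian _),
    integral_sub (integrable_eval_mul_gaussian _) (integrable_eval_mul_gaussian _),
    integral_mul_gaussian_eq_derivative]

theorem integral_gaussian_half : ∫ x : ℝ, Real.exp (-(x ^ 2 / 2)) = √(2 * Real.pi) := by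
  have h := integral_gaussian (1 / 2)
  rw [show Real.pi / (1 / 2) = 2 * Real.pi by ring] at h
  rw [← h]
  refine integral_congr_ae (Filter.Eventually.of_forall fun x => ?_)
  ring_nf

theorem integral_hermiteR_mul_hermiteR (m n : ℕ) :
    ∫ x : ℝ, (hermiteR m * hermiteR n).eval x * Real.exp (-(x ^ 2 / 2)) =
      if m = n then n.factorial * √(2 * Real.pi) else 0 := by
  induction m generalizing n with
  | zero =>
    cases n with
    | zero => simp [hermiteR_zero, integral_gaussian_half]
    | succ n =>
      rw [mul_comm, integral_hermiteR_succ_mul]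
      simp [hermiteR_zero]
  | succ m ih =>
    rw [integral_hermiteR_succ_mul]
    cases n with
    | zero => simp [hermiteR_zero]
    | succ n =>
      have h : ∀ x : ℝ, (hermiteR m * derivative (hermiteR (n + 1))).eval x *
          Real.exp (-(x ^ 2 / 2)) =
          (n + 1 : ℝ) * ((hermiteR m * hermiteR n).eval x * Real.exp (-(x ^ 2 / 2))) := by
        intro x
        rw [derivative_hermiteR_succ]
        simp
        ring
      simp_rw [h]
      rw [integral_const_mul, ih]
      by_cases hmn : m = n
      · simp [hmn, Nat.factorial_succ, mul_assoc]
      · simp [hmn]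

/-- The Hermite polynomials are eigenvectors of the Ornstein-Uhlenbeck semigroup. -/
theorem integral_hermiteR_affine {a b : ℝ} (hab : a ^ 2 + b ^ 2 = 1) (n : ℕ) (x : ℝ) :
    ∫ z : ℝ, (hermiteR n).eval (a * x + b * z) * Real.exp (-(z ^ 2 / 2)) =
      a ^ n * (hermiteR n).eval x * √(2 * Real.pi) := by
  have hcomp : ∀ (p : ℝ[X]) (z : ℝ), p.eval (a * x + b * z) =
        (p.comp (C (a * x) + C b * X)).eval z := by
    intro p z; simp
  have hint : ∀ p : ℝ[X], Integrable fun z : ℝ =>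
      p.eval (a * x + b * z) * Real.exp (-(z ^ 2 / 2)) := by
    intro p
    simp_rw [hcomp]
    exact integrable_eval_mul_gaussian _
  have hstein : ∀ p : ℝ[X],
      ∫ z : ℝ, (X * p - derivative p).eval (a * x + b * z) * Real.exp (-(z ^ 2 / 2)) =
        a * x * (∫ z : ℝ, p.eval (a * x + b * z) * Real.exp (-(z ^ 2 / 2))) -
          a ^ 2 * ∫ z : ℝ, (derivative p).eval (a * x + b * z) * Real.exp (-(z ^ 2 / 2)) := by
    intro p
    have h1 := integral_mul_gaussian_eq_derivative (p.comp (C (a * x) + C b * X))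
    have hder : derivative (p.comp (C (a * x) + C b * X)) =
        C b * (derivative p).comp (C (a * x) + C b * X) := by
      rw [derivative_comp]; simp
    have h2 : ∫ z : ℝ, (X * p.comp (C (a * x) + C b * X)).eval z * Real.exp (-(z ^ 2 / 2)) =
        b * ∫ z : ℝ, (derivative p).eval (a * x + b * z) * Real.exp (-(z ^ 2 / 2)) := by
      rw [h1, hder, ← integral_const_mul]
      refine integral_congr_ae (Filter.Eventually.of_forall fun z => ?_)
      simp only [hcomp, eval_mul, eval_C]
      ring
    have h3 : ∀ z : ℝ, (X * p - derivative p).eval (a * x + b * z) * Real.exp (-(z ^ 2 / 2)) =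
        a * x * (p.eval (a * x + b * z) * Real.exp (-(z ^ 2 / 2))) +
        b * ((X * p.comp (C (a * x) + C b * X)).eval z * Real.exp (-(z ^ 2 / 2))) -
        (derivative p).eval (a * x + b * z) * Real.exp (-(z ^ 2 / 2)) := by
      intro z
      simp only [eval_sub, eval_mul, eval_X, ← hcomp]
      ring
    simp_rw [h3]
    have i1 := (hint p).const_mul (a * x)
    have i2 := (integrable_eval_mul_gaussian (X * p.comp (C (a * x) + C b * X))).const_mul b
    have i3 : Integrable fun z => a * x * (p.eval (a * x + b * z) * Real.exp (-(z ^ 2 / 2))) +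
        b * ((X * p.comp (C (a * x) + C b * X)).eval z * Real.exp (-(z ^ 2 / 2))) := i1.add i2
    rw [integral_sub i3 (hint _), integral_add i1 i2, integral_const_mul, integral_const_mul, h2]
    linear_combination (∫ z : ℝ, (derivative p).eval (a * x + b * z) * Real.exp (-(z ^ 2 / 2))) *
          hab
  induction n using Nat.strong_induction_on with
  | _ n ih =>
    rcases n with _ | n
    · simp [hermiteR_zero, integral_gaussian_half]
    · rw [hermiteR_succ, hstein, ih n (Nat.lt_succ_self n)]
      rcases n with _ | n
      · simp [hermiteR_zero]
      · have h : ∫ z : ℝ, (derivative (hermiteR (n + 1))).eval (a * x + b * z) *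
            Real.exp (-(z ^ 2 / 2)) = (n + 1) * (a ^ n * (hermiteR n).eval x * √(2 * Real.pi)) := by
          rw [← ih n (by omega), ← integral_const_mul]
          refine integral_congr_ae (Filter.Eventually.of_forall fun z => ?_)
          simp only [derivative_hermiteR_succ]
          simp [mul_assoc]
        rw [h, derivative_hermiteR_succ]
        simp
        ring

end Hermite

section HermiteFunction

/-- The normalized Hermite functions, the eigenfunctions of the harmonic oscillator. -/
def hermiteFun (n : ℕ) (x : ℝ) : ℝ :=
  (√(√Real.pi * n.factorial))⁻¹ * ((hermiteR n).eval (√2 * x) * Real.exp (-(x ^ 2 / 2)))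

theorem continuous_hermiteFun (n : ℕ) : Continuous (hermiteFun n) := by
  unfold hermiteFun
  have := (hermiteR n).continuous
  fun_prop

theorem hermiteFun_zero (x : ℝ) : hermiteFun 0 x = (√√Real.pi)⁻¹ * Real.exp (-(x ^ 2 / 2)) := by
  simp [hermiteFun, hermiteR_zero]

theorem hermiteFun_mul (m n : ℕ) (x : ℝ) : hermiteFun m x * hermiteFun n x =
    ((√(√Real.pi * m.factorial))⁻¹ * (√(√Real.pi * n.factorial))⁻¹) *
      ((hermiteR m * hermiteR n).eval (√2 * x) * Real.exp (-((√2 * x) ^ 2 / 2))) := by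
  have h : Real.exp (-((√2 * x) ^ 2 / 2)) = Real.exp (-(x ^ 2 / 2)) * Real.exp (-(x ^ 2 / 2)) := by
    rw [← Real.exp_add, mul_pow, Real.sq_sqrt (by norm_num)]
    ring_nf
  rw [h, hermiteFun, hermiteFun, Polynomial.eval_mul]
  ring

theorem integrable_hermiteFun_mul (m n : ℕ) :
    Integrable fun x => hermiteFun m x * hermiteFun n x := by
  simp_rw [hermiteFun_mul]
  exact ((integrable_eval_mul_gaussian (hermiteR m * hermiteR n)).comp_mul_left'
    (by positivity : (√2 : ℝ) ≠ 0)).const_mul _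

theorem integral_hermiteFun_mul (m n : ℕ) :
    ∫ x, hermiteFun m x * hermiteFun n x = if m = n then 1 else 0 := by
  simp_rw [hermiteFun_mul]
  rw [integral_const_mul, Measure.integral_comp_mul_left
    (fun y => (hermiteR m * hermiteR n).eval y * Real.exp (-(y ^ 2 / 2))),
    integral_hermiteR_mul_hermiteR]
  split_ifs with h
  · subst h
    have h2 : √(2 * Real.pi) = √2 * √Real.pi := Real.sqrt_mul (by norm_num) _
    have h3 : (√(√Real.pi * m.factorial))⁻¹ * (√(√Real.pi * m.factorial))⁻¹ =
        (√Real.pi * m.factorial)⁻¹ := by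
      rw [← mul_inv, Real.mul_self_sqrt (by positivity)]
    have h4 : (0 : ℝ) < √Real.pi := Real.sqrt_pos.2 Real.pi_pos
    have h5 : (0 : ℝ) < m.factorial := by positivity
    rw [h2, h3, abs_of_pos (by positivity), smul_eq_mul]
    field_simp
  · simp

/-- The wave function of the two-mode squeezed vacuum. -/
def squeezedFun (r x y : ℝ) : ℝ :=
  hermiteFun 0 (Real.cosh r * x - Real.sinh r * y) *
    hermiteFun 0 (Real.cosh r * y - Real.sinh r * x)

theorem integral_hermiteFun_mul_squeezedFun (r : ℝ) (n : ℕ) (y : ℝ) :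
    ∫ x, hermiteFun n x * squeezedFun r x y =
      Real.tanh r ^ n / Real.cosh r * hermiteFun n y := by
  set c := Real.cosh r
  set s := Real.sinh r
  have hc : 0 < c := Real.cosh_pos r
  have hcs : c ^ 2 - s ^ 2 = 1 := Real.cosh_sq_sub_sinh_sq r
  have ht : Real.tanh r = s / c := Real.tanh_eq_sinh_div_cosh r
  have h2 : (√2 : ℝ) ^ 2 = 2 := Real.sq_sqrt (by norm_num)
  have h20 : (0 : ℝ) < √2 := by positivity
  have hτ : (s / c) ^ 2 + (1 / c) ^ 2 = 1 := by
    field_simp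
    linarith
  have hpt : ∀ x, hermiteFun n x * squeezedFun r x y =
      ((√(√Real.pi * n.factorial))⁻¹ * (√Real.pi)⁻¹ * Real.exp (-(y ^ 2 / 2))) *
        (fun z => (hermiteR n).eval ((s / c) * (√2 * y) + (1 / c) * z) *
          Real.exp (-(z ^ 2 / 2))) (√2 * c * (x - s / c * y)) := by
    intro x
    have harg : (s / c) * (√2 * y) + (1 / c) * (√2 * c * (x - s / c * y)) = √2 * x := by
      field_simp
      ring
    have hexp : Real.exp (-(x ^ 2 / 2)) * (Real.exp (-((c * x - s * y) ^ 2 / 2)) *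
        Real.exp (-((c * y - s * x) ^ 2 / 2))) =
        Real.exp (-(y ^ 2 / 2)) * Real.exp (-((√2 * c * (x - s / c * y)) ^ 2 / 2)) := by
      rw [← Real.exp_add, ← Real.exp_add, ← Real.exp_add]
      congr 1
      have : √2 * c * (x - s / c * y) = √2 * (c * x - s * y) := by field_simp
      rw [this, mul_pow, h2]
      linear_combination ((x ^ 2) / 2 - y ^ 2 / 2) * hcs
    have hπ : (√√Real.pi)⁻¹ * (√√Real.pi)⁻¹ = (√Real.pi)⁻¹ := by
      rw [← mul_inv, Real.mul_self_sqrt (by positivity)]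
    simp only [harg]
    rw [squeezedFun, hermiteFun_zero, hermiteFun_zero, hermiteFun, ← hπ]
    linear_combination ((√(√Real.pi * n.factorial))⁻¹ * ((√√Real.pi)⁻¹ * (√√Real.pi)⁻¹) *
      (hermiteR n).eval (√2 * x)) * hexp
  simp_rw [hpt]
  rw [integral_const_mul, integral_sub_right_eq_self (fun x => (fun z =>
      (hermiteR n).eval ((s / c) * (√2 * y) + (1 / c) * z) * Real.exp (-(z ^ 2 / 2)))
      (√2 * c * x)) (s / c * y), Measure.integral_comp_mul_left (fun z =>
      (hermiteR n).eval ((s / c) * (√2 * y) + (1 / c) * z) * Real.exp (-(z ^ 2 / 2))),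
    integral_hermiteR_affine hτ, ht, hermiteFun, abs_of_pos (by positivity), smul_eq_mul,
    Real.sqrt_mul (x := 2) (by norm_num)]
  have h4 : (0 : ℝ) < √Real.pi := Real.sqrt_pos.2 Real.pi_pos
  field_simp

end HermiteFunction

section NumberState

variable {ι : Type} [Fintype ι]

/-- The wave function of a number state: a product of Hermite functions. -/
def numFun (K : ι → ℕ) (x : ι → ℝ) : ℝ := ∏ i, hermiteFun (K i) (x i)

theorem continuous_numFun (K : ι → ℕ) : Continuous (numFun K) :=
  continuous_finsetProd _ fun i _ => (continuous_hermiteFun (K i)).comp (continuous_apply i)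

theorem numFun_mul (K L : ι → ℕ) (x : ι → ℝ) :
    numFun K x * numFun L x = ∏ i, hermiteFun (K i) (x i) * hermiteFun (L i) (x i) :=
  Finset.prod_mul_distrib.symm

theorem integrable_numFun_mul (K L : ι → ℕ) :
    Integrable fun x : ι → ℝ => numFun K x * numFun L x := by
  simp_rw [numFun_mul]
  exact Integrable.fintype_prod (f := fun i y => hermiteFun (K i) y * hermiteFun (L i) y)
    fun i => integrable_hermiteFun_mul (K i) (L i)

theorem integral_numFun_mul [DecidableEq ι] (K L : ι → ℕ) :
    ∫ x : ι → ℝ, numFun K x * numFun L x = if K = L then 1 else 0 := by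
  simp_rw [numFun_mul]
  rw [integral_fintype_prod_volume_eq_prod
    (fun i y => hermiteFun (K i) y * hermiteFun (L i) y)]
  simp_rw [integral_hermiteFun_mul]
  split_ifs with h
  · subst h; simp
  · obtain ⟨i, hi⟩ := Function.ne_iff.1 h
    exact Finset.prod_eq_zero (Finset.mem_univ i) (if_neg hi)

theorem memLp_numFun (K : ι → ℕ) :
    MemLp (fun x : ι → ℝ => (numFun K x : ℂ)) 2 (volume : Measure (ι → ℝ)) := by
  have hm : AEStronglyMeasurable (fun x : ι → ℝ => (numFun K x : ℂ)) volume :=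
    (Complex.continuous_ofReal.comp (continuous_numFun K)).aestronglyMeasurable
  rw [memLp_two_iff_integrable_sq_norm hm]
  refine (integrable_numFun_mul K K).congr (Filter.Eventually.of_forall fun x => ?_)
  simp [sq]

/-- The number state with occupation numbers `K`. -/
def numState (K : ι → ℕ) : ModeSpace ι := (memLp_numFun K).toLp _

theorem coeFn_numState (K : ι → ℕ) :
    (numState K : (ι → ℝ) → ℂ) =ᵐ[volume] fun x => (numFun K x : ℂ) :=
  MemLp.coeFn_toLp _

theorem orthonormal_numState : Orthonormal ℂ (numState : (ι → ℕ) → ModeSpace ι) := by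
  classical
  rw [orthonormal_iff_ite]
  intro K L
  rw [L2.inner_def]
  have h : ∫ x : ι → ℝ, inner ℂ (numState K x) (numState L x) =
      ∫ x : ι → ℝ, ((numFun K x * numFun L x : ℝ) : ℂ) := by
    refine integral_congr_ae ?_
    filter_upwards [coeFn_numState K, coeFn_numState L] with x h1 h2
    rw [h1, h2]
    simp [mul_comm]
  rw [h, integral_complex_ofReal, integral_numFun_mul]
  split_ifs <;> simp

theorem integral_hermiteFun_zero_weyl (u v : ℝ) :
    ∫ x : ℝ, Complex.exp (Complex.I * ((u * x + u * v / 2 : ℝ) : ℂ)) * (hermiteFun 0 (x + v) : ℂ) *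
      (hermiteFun 0 x : ℂ) = Complex.exp ((-(u ^ 2 + v ^ 2) / 4 : ℝ) : ℂ) := by
  have hπ : ((√√Real.pi)⁻¹ : ℝ) * (√√Real.pi)⁻¹ = (√Real.pi)⁻¹ := by
    rw [← mul_inv, Real.mul_self_sqrt (by positivity)]
  have h : ∀ x : ℝ, Complex.exp (Complex.I * ((u * x + u * v / 2 : ℝ) : ℂ)) *
      (hermiteFun 0 (x + v) : ℂ) * (hermiteFun 0 x : ℂ) = (((√Real.pi)⁻¹ : ℝ) : ℂ) *
      Complex.exp ((-1 : ℂ) * (x : ℂ) ^ 2 + (-(v : ℂ) + Complex.I * u) * x +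
        (-(v : ℂ) ^ 2 / 2 + Complex.I * u * v / 2)) := by
    intro x
    rw [hermiteFun_zero, hermiteFun_zero, ← hπ]
    push_cast
    have : Complex.exp ((-1 : ℂ) * (x : ℂ) ^ 2 + (-(v : ℂ) + Complex.I * u) * x +
        (-(v : ℂ) ^ 2 / 2 + Complex.I * u * v / 2)) =
        Complex.exp (Complex.I * (u * x + u * v / 2)) * Complex.exp (-((x + v : ℂ) ^ 2 / 2)) *
        Complex.exp (-((x : ℂ) ^ 2 / 2)) := by
      rw [← Complex.exp_add, ← Complex.exp_add]
      congr 1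
      ring
    rw [this]
    ring
  simp_rw [h]
  rw [integral_const_mul, integral_cexp_quadratic (by simp)]
  have h1 : ((Real.pi : ℂ) / -(-1 : ℂ)) ^ (1 / 2 : ℂ) = ((√Real.pi : ℝ) : ℂ) := by
    rw [Real.sqrt_eq_rpow, Complex.ofReal_cpow Real.pi_pos.le]
    norm_num
  rw [h1, ← mul_assoc, ← Complex.ofReal_mul,
    inv_mul_cancel₀ (Real.sqrt_pos.2 Real.pi_pos).ne', Complex.ofReal_one, one_mul]
  congr 1
  push_cast
  linear_combination ((u : ℂ) ^ 2 / 4) * Complex.I_sq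

/-- The characteristic function of the vacuum. -/
theorem inner_vacuum_weyl (c : ι ⊕ ι → ℝ) :
    inner ℂ (numState (0 : ι → ℕ)) (weyl c (numState 0)) =
      Complex.exp ((-(∑ j, c j ^ 2) / 4 : ℝ) : ℂ) := by
  rw [L2.inner_def]
  have h : ∫ x : ι → ℝ, inner ℂ (numState (0 : ι → ℕ) x) (weyl c (numState 0) x) =
      ∫ x : ι → ℝ, ∏ i, (Complex.exp (Complex.I *
        ((c (Sum.inl i) * x i + c (Sum.inl i) * c (Sum.inr i) / 2 : ℝ) : ℂ)) *
        (hermiteFun 0 (x i + c (Sum.inr i)) : ℂ) * (hermiteFun 0 (x i) : ℂ)) := by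
    refine integral_congr_ae ?_
    filter_upwards [coeFn_weyl c (numState 0), coeFn_numState (0 : ι → ℕ),
      (quasiMeasurePreserving_add_right (c ∘ Sum.inr)).ae (coeFn_numState (0 : ι → ℕ))]
      with x h1 h2 h3
    rw [h1, h2, weylFun, h3, Finset.prod_mul_distrib, Finset.prod_mul_distrib, ← Complex.exp_sum,
      ← Finset.mul_sum, ← Complex.ofReal_sum, Finset.sum_add_distrib, ← Finset.sum_div]
    simp [numFun]
  rw [h, integral_fintype_prod_volume_eq_prod (fun i (y : ℝ) => Complex.exp (Complex.I *
        ((c (Sum.inl i) * y + c (Sum.inl i) * c (Sum.inr i) / 2 : ℝ) : ℂ)) *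
        (hermiteFun 0 (y + c (Sum.inr i)) : ℂ) * (hermiteFun 0 y : ℂ))]
  simp_rw [integral_hermiteFun_zero_weyl]
  rw [← Complex.exp_sum, ← Complex.ofReal_sum, ← Finset.sum_div, Finset.sum_neg_distrib,
    Finset.sum_add_distrib, Fintype.sum_sum_type]

end NumberState

section Squeezing

variable {ι κ : Type} [Fintype ι] [Fintype κ] [DecidableEq ι] [DecidableEq κ]

/-- The off-diagonal block of the two-mode squeezing matrix. -/
def sinhBlock (e : ι → κ) (r : ι → ℝ) : Matrix ι κ ℝ :=
  Matrix.of fun i j => if e i = j then Real.sinh (r i) else 0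

/-- The action on positions of two-mode squeezing of the mode pairs `(i, e i)`. -/
def squeezeMatrix (e : ι → κ) (r : ι → ℝ) : Matrix (ι ⊕ κ) (ι ⊕ κ) ℝ :=
  Matrix.fromBlocks (Matrix.diagonal fun i => Real.cosh (r i)) (-sinhBlock e r)
    (-(sinhBlock e r)ᵀ) (Matrix.diagonal fun j => Real.cosh (Function.extend e r 0 j))

variable {e : ι → κ}

theorem transpose_squeezeMatrix {ι κ : Type} [DecidableEq ι] [DecidableEq κ] (e : ι → κ)
    (r : ι → ℝ) : (squeezeMatrix e r)ᵀ = squeezeMatrix e r := by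
  simp [squeezeMatrix, Matrix.fromBlocks_transpose]

theorem squeezeMatrix_mulVec_inl (r : ι → ℝ) (z : ι ⊕ κ → ℝ) (i : ι) :
    (squeezeMatrix e r *ᵥ z) (Sum.inl i) =
    Real.cosh (r i) * z (Sum.inl i) - Real.sinh (r i) * z (Sum.inr (e i)) := by
  rw [squeezeMatrix, Matrix.fromBlocks_mulVec, Sum.elim_inl, Pi.add_apply, Matrix.mulVec_diagonal,
    Matrix.neg_mulVec, Pi.neg_apply, ← sub_eq_add_neg]
  simp [Matrix.mulVec, dotProduct, sinhBlock]

theorem squeezeMatrix_mulVec_inr_apply (he : Function.Injective e) (r : ι → ℝ) (z : ι ⊕ κ → ℝ)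
    (i : ι) :
    (squeezeMatrix e r *ᵥ z) (Sum.inr (e i)) =
      Real.cosh (r i) * z (Sum.inr (e i)) - Real.sinh (r i) * z (Sum.inl i) := by
  rw [squeezeMatrix, Matrix.fromBlocks_mulVec, Sum.elim_inr, Pi.add_apply, Matrix.mulVec_diagonal,
    Matrix.neg_mulVec, Pi.neg_apply, he.extend_apply]
  simp only [Matrix.mulVec, dotProduct, sinhBlock, Matrix.transpose_apply, Matrix.of_apply,
    he.eq_iff, ite_mul, zero_mul, Finset.sum_ite_eq', Finset.mem_univ, if_true,
    Function.comp_apply]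
  ring

theorem squeezeMatrix_mulVec_inr_of_notMem (r : ι → ℝ) (z : ι ⊕ κ → ℝ) {j : κ}
    (hj : ¬ ∃ i, e i = j) :
    (squeezeMatrix e r *ᵥ z) (Sum.inr j) = z (Sum.inr j) := by
  rw [squeezeMatrix, Matrix.fromBlocks_mulVec, Sum.elim_inr, Pi.add_apply, Matrix.mulVec_diagonal,
    Matrix.neg_mulVec, Pi.neg_apply, Function.extend_apply' _ _ _ hj]
  have h : ∀ i, e i ≠ j := fun i hi => hj ⟨i, hi⟩
  simp [Matrix.mulVec, dotProduct, sinhBlock, h]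

theorem squeezeMatrix_mul_neg (he : Function.Injective e) (r : ι → ℝ) :
    squeezeMatrix e r * squeezeMatrix e (-r) = 1 := by
  refine Matrix.toLin'.injective (LinearMap.ext fun z => ?_)
  rw [Matrix.toLin'_apply, Matrix.toLin'_apply, Matrix.one_mulVec, ← Matrix.mulVec_mulVec]
  ext k
  rcases k with i | j
  · rw [squeezeMatrix_mulVec_inl, squeezeMatrix_mulVec_inl, squeezeMatrix_mulVec_inr_apply he,
      Pi.neg_apply, Real.cosh_neg, Real.sinh_neg]
    linear_combination z (Sum.inl i) * Real.cosh_sq_sub_sinh_sq (r i)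
  · by_cases hj : ∃ i, e i = j
    · obtain ⟨i, rfl⟩ := hj
      rw [squeezeMatrix_mulVec_inr_apply he, squeezeMatrix_mulVec_inl,
        squeezeMatrix_mulVec_inr_apply he, Pi.neg_apply, Real.cosh_neg, Real.sinh_neg]
      linear_combination z (Sum.inr (e i)) * Real.cosh_sq_sub_sinh_sq (r i)
    · rw [squeezeMatrix_mulVec_inr_of_notMem _ _ hj, squeezeMatrix_mulVec_inr_of_notMem _ _ hj]

theorem abs_det_squeezeMatrix (he : Function.Injective e) (r : ι → ℝ) :
    |(squeezeMatrix e r).det| = 1 := by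
  set D : Matrix (ι ⊕ κ) (ι ⊕ κ) ℝ := Matrix.fromBlocks 1 0 0 (-1)
  have hD : D * D = 1 := by
    simp [D, Matrix.fromBlocks_multiply, Matrix.fromBlocks_one]
  have hsinh : sinhBlock e (-r) = -sinhBlock e r := by
    ext i j
    simp only [sinhBlock, Matrix.of_apply, Matrix.neg_apply, Pi.neg_apply, Real.sinh_neg]
    split_ifs <;> simp
  have hext : ∀ j, Real.cosh (Function.extend e (-r) 0 j) =
      Real.cosh (Function.extend e r 0 j) := by
    intro j
    by_cases hj : ∃ i, e i = j
    · obtain ⟨i, rfl⟩ := hj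
      rw [he.extend_apply, he.extend_apply, Pi.neg_apply, Real.cosh_neg]
    · rw [Function.extend_apply' _ _ _ hj, Function.extend_apply' _ _ _ hj]
  have hconj : squeezeMatrix e (-r) = D * squeezeMatrix e r * D := by
    simp [D, squeezeMatrix, Matrix.fromBlocks_multiply, hsinh, hext]
  have h1 := congrArg Matrix.det (squeezeMatrix_mul_neg he r)
  have h2 := congrArg Matrix.det hD
  rw [hconj] at h1
  simp only [Matrix.det_mul, Matrix.det_one] at h1 h2
  have h3 : (squeezeMatrix e r).det ^ 2 = 1 := by
    linear_combination h1 - (squeezeMatrix e r).det ^ 2 * h2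
  rw [← Real.sqrt_sq_eq_abs, h3, Real.sqrt_one]

theorem measurePreserving_squeezeMatrix (he : Function.Injective e) (r : ι → ℝ) :
    MeasurePreserving (fun z : ι ⊕ κ → ℝ => squeezeMatrix e r *ᵥ z) volume volume := by
  have hdet := abs_det_squeezeMatrix he r
  refine ⟨(Matrix.toLin' (squeezeMatrix e r)).continuous_of_finiteDimensional.measurable, ?_⟩
  have h := Real.map_matrix_volume_pi_eq_smul_volume_pi (M := squeezeMatrix e r)
    (fun h0 => by rw [h0] at hdet; simp at hdet)
  rw [abs_inv, hdet, inv_one, ENNReal.ofReal_one, one_smul] at h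
  exact h

/-- The two-mode squeezing of the mode pairs `(i, e i)`. -/
def squeezeUnitary (he : Function.Injective e) (r : ι → ℝ) :
    ModeSpace (ι ⊕ κ) ≃ₗᵢ[ℂ] ModeSpace (ι ⊕ κ) :=
  pullback _ _ (squeezeMatrix_mul_neg he r) (measurePreserving_squeezeMatrix he r)
    (measurePreserving_squeezeMatrix he (-r))

theorem isGaussianUnitary_squeezeUnitary (he : Function.Injective e) (r : ι → ℝ) :
    IsGaussianUnitary (squeezeUnitary he r) :=
  isGaussianUnitary_pullback _ _ _

theorem isGaussianUnitary_squeezeUnitary_symm (he : Function.Injective e) (r : ι → ℝ) :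
    IsGaussianUnitary (squeezeUnitary he r).symm := by
  rw [squeezeUnitary, pullback_symm]
  exact isGaussianUnitary_pullback _ _ _

/-- The two-mode squeezed vacuum. -/
def squeezedState (he : Function.Injective e) (r : ι → ℝ) :
    ModeSpace (ι ⊕ κ) := squeezeUnitary he r (numState 0)

theorem norm_squeezedState (he : Function.Injective e) (r : ι → ℝ) : ‖squeezedState he r‖ = 1 := by
  rw [squeezedState, LinearIsometryEquiv.norm_map]
  exact orthonormal_numState.1 0

theorem inner_squeezedState_weyl (he : Function.Injective e) (r : ι → ℝ)
    (c : (ι ⊕ κ) ⊕ (ι ⊕ κ) → ℝ) :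
    inner ℂ (squeezedState he r) (weyl c (squeezedState he r)) =
      Complex.exp ((-(∑ k, (squeezeMatrix e (-r) *ᵥ (c ∘ Sum.inl)) k ^ 2 +
        ∑ k, (squeezeMatrix e r *ᵥ (c ∘ Sum.inr)) k ^ 2) / 4 : ℝ) : ℂ) := by
  rw [squeezedState, squeezeUnitary, weyl_pullback, LinearIsometryEquiv.inner_map_map,
    inner_vacuum_weyl, transpose_squeezeMatrix, Matrix.fromBlocks_transpose,
    Matrix.fromBlocks_mulVec, Fintype.sum_sum_type]
  simp [transpose_squeezeMatrix]

theorem isPureGaussian_squeezedState (he : Function.Injective e) (r : ι → ℝ) :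
    IsPureGaussian (squeezedState he r) := by
  set S : Matrix ((ι ⊕ κ) ⊕ (ι ⊕ κ)) ((ι ⊕ κ) ⊕ (ι ⊕ κ)) ℝ :=
    Matrix.fromBlocks (squeezeMatrix e (-r)) 0 0 (squeezeMatrix e r)ᵀ with hS
  refine ⟨S * Sᵀ, by simp [Matrix.IsSymm, Matrix.transpose_mul], fun c => ?_⟩
  rw [squeezedState, squeezeUnitary, weyl_pullback, LinearIsometryEquiv.inner_map_map,
    inner_vacuum_weyl, ← hS, ← Matrix.mulVec_mulVec, Matrix.dotProduct_mulVec,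
    ← Matrix.mulVec_transpose]
  simp [dotProduct, sq]

end Squeezing

section Schmidt

@[to_additive]
theorem prod_eq_prod_apply_mul_prod_compl {ι κ M : Type*} [Fintype ι] [Fintype κ] [DecidableEq κ]
    [CommMonoid M] {e : ι → κ} (he : Function.Injective e) (g : κ → M) :
    ∏ j, g j = (∏ i, g (e i)) * ∏ j ∈ (Finset.univ.map ⟨e, he⟩)ᶜ, g j := by
  rw [← Finset.prod_mul_prod_compl (Finset.univ.map ⟨e, he⟩), Finset.prod_map]
  rfl

theorem hasSum_of_inner_eq {G α : Type*} [NormedAddCommGroup G] [InnerProductSpace ℂ G] {g : α → G}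
    (hg : Orthonormal ℂ g) {ψ : G} {s : α → ℝ} (hs : ∀ n, inner ℂ (g n) ψ = (s n : ℂ))
    (hsum : HasSum (fun n => s n ^ 2) (‖ψ‖ ^ 2)) : HasSum (fun n => (s n : ℂ) • g n) ψ := by
  classical
  have key : ∀ F : Finset α, ‖∑ n ∈ F, (s n : ℂ) • g n - ψ‖ ^ 2 = ‖ψ‖ ^ 2 - ∑ n ∈ F, s n ^ 2 := by
    intro F
    have h1 : inner ℂ (∑ n ∈ F, (s n : ℂ) • g n) ψ = ((∑ n ∈ F, s n ^ 2 : ℝ) : ℂ) := by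
      rw [sum_inner]
      push_cast
      refine Finset.sum_congr rfl fun n _ => ?_
      rw [inner_smul_left, hs]
      simp [sq]
    have h2 : ‖∑ n ∈ F, (s n : ℂ) • g n‖ ^ 2 = ∑ n ∈ F, s n ^ 2 := by
      have h3 := hg.inner_sum (fun n => (s n : ℂ)) (fun n => (s n : ℂ)) F
      rw [inner_self_eq_norm_sq_to_K] at h3
      have h4 : ((‖∑ n ∈ F, (s n : ℂ) • g n‖ ^ 2 : ℝ) : ℂ) = ((∑ n ∈ F, s n ^ 2 : ℝ) : ℂ) := by
        push_cast
        refine h3.trans (Finset.sum_congr rfl fun n _ => ?_)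
        simp [sq]
      exact_mod_cast h4
    rw [@norm_sub_sq ℂ, h1, h2, RCLike.re_to_complex, Complex.ofReal_re]
    ring
  rw [HasSum, SummationFilter.unconditional_filter, tendsto_iff_norm_sub_tendsto_zero]
  have h0 : Filter.Tendsto (fun F : Finset α => ‖ψ‖ ^ 2 - ∑ n ∈ F, s n ^ 2) Filter.atTop
      (nhds (‖ψ‖ ^ 2 - ‖ψ‖ ^ 2)) := tendsto_const_nhds.sub hsum
  rw [sub_self] at h0
  have h1 := h0.sqrt
  rw [Real.sqrt_zero] at h1
  refine h1.congr fun F => ?_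
  rw [← key, Real.sqrt_sq (norm_nonneg _)]

variable {ι κ : Type} [Fintype ι] [Fintype κ] [DecidableEq ι] [DecidableEq κ]
  {e : ι → κ}

theorem coeFn_squeezedState (he : Function.Injective e) (r : ι → ℝ) :
    (squeezedState he r : (ι ⊕ κ → ℝ) → ℂ) =ᵐ[volume] fun z =>
      (((∏ i, squeezedFun (r i) (z (Sum.inl i)) (z (Sum.inr (e i)))) *
        ∏ j ∈ (Finset.univ.map ⟨e, he⟩)ᶜ, hermiteFun 0 (z (Sum.inr j)) : ℝ) : ℂ) := by
  filter_upwards [coeFn_pullback (squeezeMatrix_mul_neg he r) (measurePreserving_squeezeMatrix he r)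
    (measurePreserving_squeezeMatrix he (-r)) (numState 0),
    (measurePreserving_squeezeMatrix he r).quasiMeasurePreserving.ae
      (coeFn_numState (0 : ι ⊕ κ → ℕ))] with z h1 h2
  refine h1.trans (h2.trans ?_)
  congr 1
  rw [numFun, Fintype.prod_sum_type, prod_eq_prod_apply_mul_prod_compl he, ← mul_assoc,
    ← Finset.prod_mul_distrib]
  congr 1
  · refine Finset.prod_congr rfl fun i _ => ?_
    rw [squeezeMatrix_mulVec_inl, squeezeMatrix_mulVec_inr_apply he, squeezedFun]
    rfl
  · refine Finset.prod_congr rfl fun j hj => ?_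
    rw [squeezeMatrix_mulVec_inr_of_notMem _ _ (by simpa using hj)]
    rfl

theorem inner_tensor_squeezedState (he : Function.Injective e) (r : ι → ℝ) (K : ι → ℕ) :
    inner ℂ (tensor (numState K) (numState (Function.extend e K 0))) (squeezedState he r) =
      ((∏ i, Real.tanh (r i) ^ K i / Real.cosh (r i) : ℝ) : ℂ) := by
  set K' : κ → ℕ := Function.extend e K 0 with hK'
  set f : (ι ⊕ κ → ℝ) → ℂ := fun z =>
    (((∏ i, hermiteFun (K i) (z (Sum.inl i)) *
        squeezedFun (r i) (z (Sum.inl i)) (z (Sum.inr (e i)))) *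
      (numFun K' (fun j => z (Sum.inr j)) *
        ∏ j ∈ (Finset.univ.map ⟨e, he⟩)ᶜ, hermiteFun 0 (z (Sum.inr j))) : ℝ) : ℂ) with hf
  have hae : (fun z => inner ℂ (tensor (numState K) (numState K') z) (squeezedState he r z))
      =ᵐ[volume] f := by
    filter_upwards [coeFn_tensor (numState K) (numState K'), coeFn_squeezedState he r,
      quasi_inl.ae (coeFn_numState K), quasi_inr.ae (coeFn_numState K')] with z h1 h2 h3 h4
    rw [h1, h2, tensorFun, h3, h4, RCLike.inner_apply, ← Complex.ofReal_mul, Complex.conj_ofReal,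
      ← Complex.ofReal_mul, hf]
    congr 1
    rw [Finset.prod_mul_distrib, numFun]
    simp only [Function.comp_apply, numFun]
    ring
  have hint : Integrable f := (L2.integrable_inner _ _).congr hae
  rw [L2.inner_def, integral_congr_ae hae, integral_sum_pi]
  have hint' : Integrable (fun w : (ι → ℝ) × (κ → ℝ) => f (Sum.elim w.1 w.2)) :=
    (volume_measurePreserving_sumPiEquivProdPi_symm (fun _ : ι ⊕ κ => ℝ)).integrable_comp_emb
      (MeasurableEquiv.measurableEmbedding _) |>.2 hint
  rw [Measure.volume_eq_prod, integral_prod_symm _ hint']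
  have hx : ∀ y : κ → ℝ, ∫ x : ι → ℝ, f (Sum.elim x y) =
      (((∏ i, Real.tanh (r i) ^ K i / Real.cosh (r i)) * (numFun K' y * numFun K' y) : ℝ) : ℂ) := by
    intro y
    simp only [hf, Sum.elim_inl, Sum.elim_inr]
    rw [integral_complex_ofReal, integral_mul_const, integral_fintype_prod_volume_eq_prod
        (fun i x =>
      hermiteFun (K i) x * squeezedFun (r i) x (y (e i)))]
    simp_rw [integral_hermiteFun_mul_squeezedFun]
    congr 1
    rw [Finset.prod_mul_distrib]
    have hn : numFun K' y = (∏ i, hermiteFun (K i) (y (e i))) *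
        ∏ j ∈ (Finset.univ.map ⟨e, he⟩)ᶜ, hermiteFun 0 (y j) := by
      rw [numFun, prod_eq_prod_apply_mul_prod_compl he]
      congr 1
      · refine Finset.prod_congr rfl fun i _ => ?_
        rw [hK', he.extend_apply]
      · refine Finset.prod_congr rfl fun j hj => ?_
        rw [hK', Function.extend_apply' _ _ _ (by simpa using hj)]
        rfl
    rw [hn]
    ring
  simp_rw [hx]
  rw [integral_complex_ofReal, integral_const_mul, integral_numFun_mul, if_pos rfl, mul_one]

end Schmidt

section Geometric

/-- The Schmidt coefficients of the two-mode squeezed vacuum. -/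
def schmidtCoeff (t : ℝ) (k : ℕ) : ℝ := Real.tanh t ^ k / Real.cosh t

/-- The entropy of a thermal state with mean occupation number `n`. -/
def thermalEntropy (n : ℝ) : ℝ := (n + 1) * Real.log (n + 1) - n * Real.log n

theorem tanh_sq_lt_one (t : ℝ) : Real.tanh t ^ 2 < 1 := by
  have hc := Real.cosh_pos t
  rw [Real.tanh_eq_sinh_div_cosh, div_pow, div_lt_one (by positivity)]
  linarith [Real.cosh_sq_sub_sinh_sq t]

theorem one_sub_tanh_sq (t : ℝ) : 1 - Real.tanh t ^ 2 = (Real.cosh t ^ 2)⁻¹ := by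
  have hc := Real.cosh_pos t
  rw [Real.tanh_eq_sinh_div_cosh]
  field_simp
  linarith [Real.cosh_sq_sub_sinh_sq t]

theorem schmidtCoeff_sq (t : ℝ) (k : ℕ) :
    schmidtCoeff t k ^ 2 = (Real.tanh t ^ 2) ^ k * (1 - Real.tanh t ^ 2) := by
  rw [one_sub_tanh_sq, schmidtCoeff, div_pow, ← pow_mul, ← pow_mul, mul_comm k 2, div_eq_mul_inv]

theorem hasSum_schmidtCoeff_sq (t : ℝ) : HasSum (fun k => schmidtCoeff t k ^ 2) 1 := by
  have h1 := tanh_sq_lt_one t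
  have h := (hasSum_geometric_of_lt_one (sq_nonneg (Real.tanh t)) h1).mul_right
    (1 - Real.tanh t ^ 2)
  rw [inv_mul_cancel₀ (by linarith)] at h
  simpa only [schmidtCoeff_sq] using h

theorem schmidtCoeff_sq_le_one (t : ℝ) (k : ℕ) : schmidtCoeff t k ^ 2 ≤ 1 :=
  le_hasSum (hasSum_schmidtCoeff_sq t) k fun _ _ => sq_nonneg _

theorem negMulLog_schmidtCoeff_sq (t : ℝ) (k : ℕ) :
    Real.negMulLog (schmidtCoeff t k ^ 2) =
      -Real.log (1 - Real.tanh t ^ 2) * ((Real.tanh t ^ 2) ^ k * (1 - Real.tanh t ^ 2)) +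
      -(Real.log (Real.tanh t ^ 2) * (1 - Real.tanh t ^ 2)) * (k * (Real.tanh t ^ 2) ^ k) := by
  have h1 := tanh_sq_lt_one t
  rw [schmidtCoeff_sq, Real.negMulLog]
  set l := Real.tanh t ^ 2
  rcases eq_or_ne l 0 with h0 | h0
  · rcases k with _ | k <;> simp [h0]
  · rw [Real.log_mul (pow_ne_zero _ h0) (by linarith), Real.log_pow]
    ring

theorem hasSum_negMulLog_schmidtCoeff_sq (t : ℝ) :
    HasSum (fun k => Real.negMulLog (schmidtCoeff t k ^ 2)) (thermalEntropy (Real.sinh t ^ 2)) := by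
  have h1 := tanh_sq_lt_one t
  have h2 := sq_nonneg (Real.tanh t)
  have hs := hasSum_schmidtCoeff_sq t
  simp only [schmidtCoeff_sq] at hs
  have hk := hasSum_coe_mul_geometric_of_norm_lt_one (r := Real.tanh t ^ 2)
    (by rwa [Real.norm_eq_abs, abs_of_nonneg h2])
  have h := (hs.mul_left (-Real.log (1 - Real.tanh t ^ 2))).add
    (hk.mul_left (-(Real.log (Real.tanh t ^ 2) * (1 - Real.tanh t ^ 2))))
  simp only [negMulLog_schmidtCoeff_sq]
  suffices hv : thermalEntropy (Real.sinh t ^ 2) = -Real.log (1 - Real.tanh t ^ 2) * 1 +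
      -(Real.log (Real.tanh t ^ 2) * (1 - Real.tanh t ^ 2)) *
        (Real.tanh t ^ 2 / (1 - Real.tanh t ^ 2) ^ 2) by
    rw [hv]; exact h
  have hc := Real.cosh_pos t
  have hc2 : Real.sinh t ^ 2 + 1 = Real.cosh t ^ 2 := by
    linarith [Real.cosh_sq_sub_sinh_sq t]
  rw [thermalEntropy, one_sub_tanh_sq, hc2, Real.log_inv]
  rcases eq_or_ne (Real.sinh t) 0 with h0 | h0
  · rw [h0] at hc2
    simp [Real.tanh_eq_sinh_div_cosh, h0, ← hc2]
  · have ht : Real.log (Real.tanh t ^ 2) =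
        Real.log (Real.sinh t ^ 2) - Real.log (Real.cosh t ^ 2) := by
      rw [Real.tanh_eq_sinh_div_cosh, div_pow, Real.log_div (by positivity) (by positivity)]
    rw [ht, Real.tanh_eq_sinh_div_cosh]
    field_simp
    linear_combination -(Real.log (Real.cosh t ^ 2)) * hc2

theorem negMulLog_schmidtCoeff_sq_nonneg (t : ℝ) (k : ℕ) :
    0 ≤ Real.negMulLog (schmidtCoeff t k ^ 2) :=
  Real.negMulLog_nonneg (sq_nonneg _) (schmidtCoeff_sq_le_one t k)

theorem thermalEntropy_sinh_sq_nonneg (t : ℝ) : 0 ≤ thermalEntropy (Real.sinh t ^ 2) :=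
  (hasSum_negMulLog_schmidtCoeff_sq t).nonneg (negMulLog_schmidtCoeff_sq_nonneg t)

theorem tsum_ofReal_negMulLog_mul (a b : ℝ) :
    ∑' n : ℕ × ℕ, ENNReal.ofReal
      (Real.negMulLog ((schmidtCoeff a n.1 * schmidtCoeff b n.2) ^ 2)) =
      ENNReal.ofReal (thermalEntropy (Real.sinh a ^ 2) + thermalEntropy (Real.sinh b ^ 2)) := by
  have hsum : ∀ t, ∑' k, ENNReal.ofReal (schmidtCoeff t k ^ 2) = 1 := fun t => by
    rw [← ENNReal.ofReal_tsum_of_nonneg (fun _ => sq_nonneg _) (hasSum_schmidtCoeff_sq t).summable,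
      (hasSum_schmidtCoeff_sq t).tsum_eq, ENNReal.ofReal_one]
  have hent : ∀ t, ∑' k, ENNReal.ofReal (Real.negMulLog (schmidtCoeff t k ^ 2)) =
      ENNReal.ofReal (thermalEntropy (Real.sinh t ^ 2)) := fun t => by
    rw [← ENNReal.ofReal_tsum_of_nonneg (negMulLog_schmidtCoeff_sq_nonneg t)
      (hasSum_negMulLog_schmidtCoeff_sq t).summable, (hasSum_negMulLog_schmidtCoeff_sq t).tsum_eq]
  have hterm : ∀ k l, ENNReal.ofReal (Real.negMulLog ((schmidtCoeff a k * schmidtCoeff b l) ^ 2)) =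
      ENNReal.ofReal (Real.negMulLog (schmidtCoeff a k ^ 2)) *
        ENNReal.ofReal (schmidtCoeff b l ^ 2) +
      ENNReal.ofReal (schmidtCoeff a k ^ 2) *
        ENNReal.ofReal (Real.negMulLog (schmidtCoeff b l ^ 2)) := by
    intro k l
    have ha := negMulLog_schmidtCoeff_sq_nonneg a k
    have hb := negMulLog_schmidtCoeff_sq_nonneg b l
    rw [← ENNReal.ofReal_mul ha, ← ENNReal.ofReal_mul (sq_nonneg _),
      ← ENNReal.ofReal_add (mul_nonneg ha (sq_nonneg _)) (mul_nonneg (sq_nonneg _) hb), mul_pow,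
      Real.negMulLog_mul]
    ring_nf
  rw [ENNReal.tsum_prod (f := fun k l => ENNReal.ofReal
    (Real.negMulLog ((schmidtCoeff a k * schmidtCoeff b l) ^ 2)))]
  simp_rw [hterm, ENNReal.tsum_add, ENNReal.tsum_mul_left, ENNReal.tsum_mul_right, hsum, hent]
  rw [one_mul, mul_one, ENNReal.ofReal_add (thermalEntropy_sinh_sq_nonneg a)
    (thermalEntropy_sinh_sq_nonneg b)]

theorem continuous_thermalEntropy : Continuous thermalEntropy := by
  have h : thermalEntropy = fun n => Real.negMulLog n - Real.negMulLog (n + 1) := by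
    funext n
    simp only [thermalEntropy, Real.negMulLog]
    ring
  rw [h]
  exact Real.continuous_negMulLog.sub (Real.continuous_negMulLog.comp (continuous_add_const 1))

theorem exists_thermalEntropy_eq_two_mul :
    ∃ b : ℝ, 2 < b ∧ thermalEntropy b = 2 * thermalEntropy 1 := by
  have h1 : 2 * thermalEntropy 1 = Real.log 16 := by
    rw [thermalEntropy, show (16 : ℝ) = 2 ^ 4 by norm_num, Real.log_pow]
    norm_num
    ring
  have h2 : thermalEntropy 2 < Real.log 16 := by
    have h3 : thermalEntropy 2 = Real.log (27 / 4) := by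
      rw [thermalEntropy, Real.log_div (by norm_num) (by norm_num),
        show (27 : ℝ) = 3 ^ 3 by norm_num, show (4 : ℝ) = 2 ^ 2 by norm_num, Real.log_pow,
        Real.log_pow]
      norm_num
    rw [h3]
    exact Real.log_lt_log (by norm_num) (by norm_num)
  have h15 : Real.log 16 ≤ thermalEntropy 15 := by
    have h4 : Real.log 15 ≤ Real.log 16 := Real.log_le_log (by norm_num) (by norm_num)
    rw [thermalEntropy, show (15 : ℝ) + 1 = 16 by norm_num]
    linarith
  obtain ⟨b, hb, hb'⟩ := intermediate_value_Icc (by norm_num : (2 : ℝ) ≤ 15)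
    continuous_thermalEntropy.continuousOn ⟨h2.le, h15⟩
  refine ⟨b, lt_of_le_of_ne hb.1 ?_, hb'.trans h1.symm⟩
  rintro rfl
  exact h2.ne hb'

end Geometric

section ReducedEntropy

variable {ι κ : Type} [Fintype ι] [Fintype κ]

theorem vonNeumannEntropy_partialTraceRight {α : Type} {ψ : ModeSpace (ι ⊕ κ)} {s : α → ℝ}
    {f : α → ModeSpace ι} {g : α → ModeSpace κ} (hf : Orthonormal ℂ f) (hg : Orthonormal ℂ g)
    (hs : Summable fun n => s n ^ 2) (hψ : HasSum (fun n => (s n : ℂ) • tensor (f n) (g n)) ψ) :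
    vonNeumannEntropy (partialTraceRight (pureState ψ)) =
      ∑' n, ENNReal.ofReal (Real.negMulLog (s n ^ 2)) := by
  have h := isDiagonalOn_partialTrace (B := tensor) inner_tensor (onb (ModeSpace κ)) hg hψ
  exact h.vonNeumannEntropy_eq hf hs

theorem vonNeumannEntropy_partialTraceLeft {α : Type} {ψ : ModeSpace (ι ⊕ κ)} {s : α → ℝ}
    {f : α → ModeSpace ι} {g : α → ModeSpace κ} (hf : Orthonormal ℂ f) (hg : Orthonormal ℂ g)
    (hs : Summable fun n => s n ^ 2) (hψ : HasSum (fun n => (s n : ℂ) • tensor (f n) (g n)) ψ) :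
    vonNeumannEntropy (partialTraceLeft (pureState ψ)) =
      ∑' n, ENNReal.ofReal (Real.negMulLog (s n ^ 2)) := by
  have hB : ∀ (g g' : ModeSpace κ) (f f' : ModeSpace ι), inner ℂ
      (tensor.flip g f : ModeSpace (ι ⊕ κ)) (tensor.flip g' f') = inner ℂ g g' * inner ℂ f f' := by
    intro g g' f f'
    rw [ContinuousLinearMap.flip_apply, ContinuousLinearMap.flip_apply, inner_tensor, mul_comm]
  have hψ' : HasSum (fun n => (s n : ℂ) • (tensor.flip (g n) (f n) : ModeSpace (ι ⊕ κ))) ψ := by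
    simpa only [ContinuousLinearMap.flip_apply] using hψ
  have h := isDiagonalOn_partialTrace hB (onb (ModeSpace ι)) hf hψ'
  rw [ContinuousLinearMap.flip_flip] at h
  exact h.vonNeumannEntropy_eq hg hs

end ReducedEntropy

section TwoPairs

/-- The family with values `a` at `i`, `b` at `j` and `0` elsewhere. -/
def twoSingle {ι R : Type*} [DecidableEq ι] [AddCommMonoid R] (i j : ι) (a b : R) : ι → R :=
  Pi.single i a + Pi.single j b

theorem twoSingle_left {ι R : Type*} [DecidableEq ι] [AddCommMonoid R] {i j : ι} (hij : i ≠ j)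
    (a b : R) : twoSingle i j a b i = a := by
  simp [twoSingle, hij]

theorem twoSingle_right {ι R : Type*} [DecidableEq ι] [AddCommMonoid R] {i j : ι} (hij : i ≠ j)
    (a b : R) : twoSingle i j a b j = b := by
  simp [twoSingle, hij.symm]

theorem twoSingle_of_ne {ι R : Type*} [DecidableEq ι] [AddCommMonoid R] {i j k : ι} (hi : k ≠ i)
    (hj : k ≠ j) (a b : R) : twoSingle i j a b k = 0 := by
  simp [twoSingle, hi, hj]

theorem twoSingle_injective {ι R : Type*} [DecidableEq ι] [AddCommMonoid R] {i j : ι}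
    (hij : i ≠ j) : Function.Injective fun n : R × R => twoSingle i j n.1 n.2 := by
  intro n m h
  refine Prod.ext ?_ ?_
  · simpa [twoSingle_left hij] using congrFun h i
  · simpa [twoSingle_right hij] using congrFun h j

variable {ι κ : Type} [Fintype ι] [Fintype κ] [DecidableEq ι] [DecidableEq κ] {e : ι → κ}
  {i j : ι}

theorem hasSum_schmidt (he : Function.Injective e) (hij : i ≠ j) (a b : ℝ) :
    HasSum (fun n : ℕ × ℕ => ((schmidtCoeff a n.1 * schmidtCoeff b n.2 : ℝ) : ℂ) •
      tensor (numState (twoSingle i j n.1 n.2))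
        (numState (Function.extend e (twoSingle i j n.1 n.2) 0)))
      (squeezedState he (twoSingle i j a b)) := by
  refine hasSum_of_inner_eq ?_ (fun n => ?_) ?_
  · rw [orthonormal_iff_ite]
    intro n m
    rw [inner_tensor, orthonormal_iff_ite.1 orthonormal_numState,
      orthonormal_iff_ite.1 orthonormal_numState]
    by_cases h : n = m
    · simp [h]
    · rw [if_neg fun h' => h (twoSingle_injective hij h'), if_neg h, zero_mul]
  · rw [inner_tensor_squeezedState, Fintype.prod_eq_mul i j hij]
    · rw [twoSingle_left hij, twoSingle_left hij, twoSingle_right hij, twoSingle_right hij,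
        schmidtCoeff, schmidtCoeff]
    · rintro k ⟨hi, hj⟩
      rw [twoSingle_of_ne hi hj, twoSingle_of_ne hi hj]
      simp
  · rw [norm_squeezedState]
    have ha := hasSum_schmidtCoeff_sq a
    have hb := hasSum_schmidtCoeff_sq b
    have h := ha.mul hb (ha.summable.mul_of_nonneg hb.summable (fun _ => sq_nonneg _)
      fun _ => sq_nonneg _)
    simpa only [mul_pow, one_pow, one_mul] using h

theorem mutualInformation_squeezedState (he : Function.Injective e) (hij : i ≠ j) (a b : ℝ) :
    mutualInformation (squeezedState he (twoSingle i j a b)) =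
      2 * (thermalEntropy (Real.sinh a ^ 2) + thermalEntropy (Real.sinh b ^ 2)) := by
  set K : ℕ × ℕ → ι → ℕ := fun n => twoSingle i j n.1 n.2 with hK
  have hKinj : Function.Injective K := twoSingle_injective hij
  have hE : Orthonormal ℂ fun n => numState (K n) := orthonormal_numState.comp K hKinj
  have hF : Orthonormal ℂ fun n => numState (Function.extend e (K n) 0) := by
    refine orthonormal_numState.comp (fun n => Function.extend e (K n) 0) fun n m h => hKinj ?_
    funext k
    simpa only [he.extend_apply] using congrFun h (e k)
  have hψ := hasSum_schmidt he hij a b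
  have hp : Summable fun n : ℕ × ℕ => (schmidtCoeff a n.1 * schmidtCoeff b n.2) ^ 2 := by
    simpa only [mul_pow] using (hasSum_schmidtCoeff_sq a).summable.mul_of_nonneg
      (hasSum_schmidtCoeff_sq b).summable (fun _ => sq_nonneg _) fun _ => sq_nonneg _
  rw [mutualInformation, vonNeumannEntropy_partialTraceRight hE hF hp hψ,
    vonNeumannEntropy_partialTraceLeft hE hF hp hψ, tsum_ofReal_negMulLog_mul,
    vonNeumannEntropy_pureState (norm_squeezedState he _), ENNReal.toReal_ofReal
      (add_nonneg (thermalEntropy_sinh_sq_nonneg a) (thermalEntropy_sinh_sq_nonneg b)),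
    ENNReal.toReal_zero]
  ring

end TwoPairs

section Quadrature

variable {ι : Type} [Fintype ι] [DecidableEq ι]

theorem quadratureSq_le {ψ : ModeSpace ι} (hψ : ‖ψ‖ = 1) {k : ι ⊕ ι} {v : ℝ} (hv : 0 ≤ v)
    (h : ∀ t : ℝ, Real.exp (-(t ^ 2 * v) / 4) ≤ (inner ℂ ψ (weyl (Pi.single k t) ψ)).re) :
    quadratureSq k ψ ≤ ENNReal.ofReal (v / 2) := by
  refine iSup_le fun t => ENNReal.ofReal_le_ofReal ?_
  rcases eq_or_ne t 0 with rfl | ht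
  · simp only [ne_eq, OfNat.ofNat_ne_zero, not_false_eq_true, zero_pow, div_zero]
    positivity
  · rw [div_le_iff₀ (by positivity), norm_weyl_sub_sq _ hψ]
    linarith [h t, Real.add_one_le_exp (-(t ^ 2 * v) / 4)]

theorem le_quadratureSq {ψ : ModeSpace ι} (hψ : ‖ψ‖ = 1) {k : ι ⊕ ι} {v : ℝ} (hv : 0 ≤ v)
    (h : ∀ t : ℝ, (inner ℂ ψ (weyl (Pi.single k t) ψ)).re ≤ Real.exp (-(t ^ 2 * v) / 4)) :
    ENNReal.ofReal (v / 2) ≤ quadratureSq k ψ := by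
  have hlim : Filter.Tendsto (fun t : ℝ => ENNReal.ofReal (v / 2 / (1 + t ^ 2 * v / 4)))
      (nhdsWithin 0 {0}ᶜ) (nhds (ENNReal.ofReal (v / 2))) := by
    refine ENNReal.tendsto_ofReal (Filter.Tendsto.mono_left ?_ nhdsWithin_le_nhds)
    have hc : ContinuousAt (fun t : ℝ => v / 2 / (1 + t ^ 2 * v / 4)) 0 :=
      ContinuousAt.div (by fun_prop) (by fun_prop) (by simp)
    simpa [ContinuousAt] using hc
  refine le_of_tendsto hlim ?_
  filter_upwards [self_mem_nhdsWithin] with t ht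
  have ht0 : t ≠ 0 := ht
  refine le_trans (ENNReal.ofReal_le_ofReal ?_)
    (le_iSup (fun t : ℝ => ENNReal.ofReal (‖weyl (Pi.single k t) ψ - ψ‖ ^ 2 / t ^ 2)) t)
  rw [norm_weyl_sub_sq _ hψ, le_div_iff₀ (by positivity)]
  set x := t ^ 2 * v / 4 with hx
  have hx0 : 0 ≤ x := by positivity
  have h1 : Real.exp (-(t ^ 2 * v) / 4) ≤ (1 + x)⁻¹ := by
    rw [show -(t ^ 2 * v) / 4 = -x by rw [hx]; ring, Real.exp_neg]
    exact inv_anti₀ (by positivity) (by linarith [Real.add_one_le_exp x])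
  have h2 : v / 2 / (1 + x) * t ^ 2 = 2 - 2 * (1 + x)⁻¹ := by
    field_simp
    rw [hx]
    ring
  rw [h2]
  linarith [h t]

/-- A symplectic map does not decrease the weighted trace of a covariance matrix in Williamson
normal form. -/
theorem two_mul_sum_le_of_symplectic {S : Matrix (ι ⊕ ι) (ι ⊕ ι) ℝ}
    (hS : S ∈ Matrix.symplecticGroup ι ℝ) {D : ι → ℝ} (hD : ∀ i, 0 ≤ D i) :
    2 * ∑ i, D i ≤
      ∑ k, ∑ i, D i * (S k (Sum.inl i) ^ 2 + S k (Sum.inr i) ^ 2) := by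
  rw [Finset.sum_comm, Finset.mul_sum]
  refine Finset.sum_le_sum fun i _ => ?_
  rw [← Finset.mul_sum, mul_comm]
  refine mul_le_mul_of_nonneg_left ?_ (hD i)
  have h := congrFun (congrFun (SymplecticGroup.mem_iff'.1 hS) (Sum.inl i)) (Sum.inr i)
  rw [Matrix.mul_apply] at h
  simp only [Matrix.mul_apply, Matrix.J, Fintype.sum_sum_type, Matrix.transpose_apply,
    Matrix.fromBlocks_apply₁₁, Matrix.fromBlocks_apply₁₂, Matrix.fromBlocks_apply₂₁,
    Matrix.fromBlocks_apply₂₂, Matrix.zero_apply, Matrix.neg_apply, Matrix.one_apply, mul_zero,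
    Finset.sum_const_zero, zero_add, add_zero, mul_ite, mul_neg, mul_one, Finset.sum_ite_eq',
    Finset.mem_univ, if_true, Finset.sum_neg_distrib, neg_mul] at h
  rw [Fintype.sum_sum_type, ← Finset.sum_add_distrib]
  have h2 : (2 : ℝ) = ∑ l, 2 * (S (Sum.inl l) (Sum.inl i) * S (Sum.inr l) (Sum.inr i) -
      S (Sum.inr l) (Sum.inl i) * S (Sum.inl l) (Sum.inr i)) := by
    rw [← Finset.mul_sum, Finset.sum_sub_distrib]
    linarith
  rw [h2]
  refine Finset.sum_le_sum fun l _ => ?_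
  nlinarith [sq_nonneg (S (Sum.inl l) (Sum.inl i) - S (Sum.inr l) (Sum.inr i)),
    sq_nonneg (S (Sum.inr l) (Sum.inl i) + S (Sum.inl l) (Sum.inr i))]

end Quadrature

section PhaseSpace

variable {ι κ : Type}

/-- The label of a quadrature of `ι` as a quadrature of `ι ⊕ κ`. -/
def quadInl (k : ι ⊕ ι) : (ι ⊕ κ) ⊕ (ι ⊕ κ) := Sum.map Sum.inl Sum.inl k

/-- The label of a quadrature of `κ` as a quadrature of `ι ⊕ κ`. -/
def quadInr (k : κ ⊕ κ) : (ι ⊕ κ) ⊕ (ι ⊕ κ) := Sum.map Sum.inr Sum.inr k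

theorem single_quadInl [DecidableEq ι] [DecidableEq κ] (k : ι ⊕ ι) (t : ℝ) :
    (Pi.single (quadInl k) t : (ι ⊕ κ) ⊕ (ι ⊕ κ) → ℝ) = joinPhase (Pi.single k t) 0 := by
  funext l
  rcases k with k | k <;> rcases l with (l | l) | (l | l) <;>
    simp [quadInl, joinPhase, Pi.single_apply]

theorem single_quadInr [DecidableEq ι] [DecidableEq κ] (k : κ ⊕ κ) (t : ℝ) :
    (Pi.single (quadInr k) t : (ι ⊕ κ) ⊕ (ι ⊕ κ) → ℝ) = joinPhase 0 (Pi.single k t) := by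
  funext l
  rcases k with k | k <;> rcases l with (l | l) | (l | l) <;>
    simp [quadInr, joinPhase, Pi.single_apply]

theorem sum_quad [Fintype ι] [Fintype κ] {M : Type*} [AddCommMonoid M] (f : (ι ⊕ κ) ⊕ (ι ⊕ κ) → M) :
    ∑ k, f k = ∑ k, f (quadInl k) + ∑ k, f (quadInr k) := by
  simp only [Fintype.sum_sum_type, quadInl, quadInr, Sum.map_inl, Sum.map_inr]
  exact add_add_add_comm _ _ _ _

theorem resInl_joinPhase (a : ι ⊕ ι → ℝ) (b : κ ⊕ κ → ℝ) : resInl (joinPhase a b) = a := by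
  funext k
  rcases k with k | k <;> rfl

theorem resInr_joinPhase (a : ι ⊕ ι → ℝ) (b : κ ⊕ κ → ℝ) : resInr (joinPhase a b) = b := by
  funext k
  rcases k with k | k <;> rfl

end PhaseSpace

section Energy

variable {ι κ : Type} [Fintype ι] [Fintype κ] [DecidableEq ι] [DecidableEq κ] {e : ι → κ}

theorem sum_sq_squeezeMatrix_inl (he : Function.Injective e) (r x : ι → ℝ) :
    ∑ k, (squeezeMatrix e r *ᵥ Sum.elim x 0) k ^ 2 = ∑ i, Real.cosh (2 * r i) * x i ^ 2 := by
  rw [Fintype.sum_sum_type, sum_eq_sum_apply_add_sum_compl he, Finset.sum_eq_zero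
    (s := (Finset.univ.map ⟨e, he⟩)ᶜ), add_zero, ← Finset.sum_add_distrib]
  · refine Finset.sum_congr rfl fun i _ => ?_
    rw [squeezeMatrix_mulVec_inl, squeezeMatrix_mulVec_inr_apply he, Real.cosh_two_mul]
    simp
    ring
  · intro j hj
    rw [squeezeMatrix_mulVec_inr_of_notMem _ _ (by simpa using hj)]
    simp

theorem sum_sq_squeezeMatrix_inr (he : Function.Injective e) (r : ι → ℝ) (y : κ → ℝ) :
    ∑ k, (squeezeMatrix e r *ᵥ Sum.elim 0 y) k ^ 2 =
      ∑ j, Real.cosh (2 * Function.extend e r 0 j) * y j ^ 2 := by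
  rw [Fintype.sum_sum_type, sum_eq_sum_apply_add_sum_compl he, ← add_assoc,
    ← Finset.sum_add_distrib, sum_eq_sum_apply_add_sum_compl he fun j =>
      Real.cosh (2 * Function.extend e r 0 j) * y j ^ 2]
  congr 1
  · refine Finset.sum_congr rfl fun i _ => ?_
    rw [squeezeMatrix_mulVec_inl, squeezeMatrix_mulVec_inr_apply he, Real.cosh_two_mul,
      he.extend_apply]
    simp
    ring
  · refine Finset.sum_congr rfl fun j hj => ?_
    rw [squeezeMatrix_mulVec_inr_of_notMem _ _ (by simpa using hj),
      Function.extend_apply' _ _ _ (by simpa using hj)]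
    simp

theorem cosh_extend_neg {ι κ : Type} {e : ι → κ} (he : Function.Injective e) (r : ι → ℝ) (j : κ) :
    Real.cosh (2 * Function.extend e (-r) 0 j) = Real.cosh (2 * Function.extend e r 0 j) := by
  by_cases hj : ∃ i, e i = j
  · obtain ⟨i, rfl⟩ := hj
    rw [he.extend_apply, he.extend_apply, Pi.neg_apply, mul_neg, Real.cosh_neg]
  · rw [Function.extend_apply' _ _ _ hj, Function.extend_apply' _ _ _ hj]

theorem inner_squeezedState_weyl_inl (he : Function.Injective e) (r : ι → ℝ) (a : ι ⊕ ι → ℝ) :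
    inner ℂ (squeezedState he r) (weyl (joinPhase a 0) (squeezedState he r)) =
      Complex.exp ((-(∑ i, Real.cosh (2 * r i) *
        (a (Sum.inl i) ^ 2 + a (Sum.inr i) ^ 2)) / 4 : ℝ) : ℂ) := by
  have h1 : (joinPhase a (0 : κ ⊕ κ → ℝ)) ∘ Sum.inl = Sum.elim (a ∘ Sum.inl) 0 := rfl
  have h2 : (joinPhase a (0 : κ ⊕ κ → ℝ)) ∘ Sum.inr = Sum.elim (a ∘ Sum.inr) 0 := rfl
  rw [inner_squeezedState_weyl, h1, h2, sum_sq_squeezeMatrix_inl he, sum_sq_squeezeMatrix_inl he,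
    ← Finset.sum_add_distrib]
  simp [mul_add]

theorem inner_squeezedState_weyl_inr (he : Function.Injective e) (r : ι → ℝ) (b : κ ⊕ κ → ℝ) :
    inner ℂ (squeezedState he r) (weyl (joinPhase 0 b) (squeezedState he r)) =
      Complex.exp ((-(∑ j, Real.cosh (2 * Function.extend e r 0 j) *
        (b (Sum.inl j) ^ 2 + b (Sum.inr j) ^ 2)) / 4 : ℝ) : ℂ) := by
  have h1 : (joinPhase (0 : ι ⊕ ι → ℝ) b) ∘ Sum.inl = Sum.elim (0 : ι → ℝ) (b ∘ Sum.inl) := rfl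
  have h2 : (joinPhase (0 : ι ⊕ ι → ℝ) b) ∘ Sum.inr = Sum.elim (0 : ι → ℝ) (b ∘ Sum.inr) := rfl
  rw [inner_squeezedState_weyl, h1, h2, sum_sq_squeezeMatrix_inr he, sum_sq_squeezeMatrix_inr he,
    ← Finset.sum_add_distrib]
  simp [mul_add, cosh_extend_neg he]

/-- The energy of the two-mode squeezed vacuum. -/
def squeezedEnergy {ι κ : Type} [Fintype ι] [Fintype κ] (e : ι → κ) (r : ι → ℝ) : ℝ :=
  (∑ i, Real.cosh (2 * r i) + ∑ j, Real.cosh (2 * Function.extend e r 0 j)) / 2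

theorem energy_squeezedState_le (he : Function.Injective e) (r : ι → ℝ) :
    energy (squeezedState he r) ≤ ENNReal.ofReal (squeezedEnergy e r) := by
  have hnorm := norm_squeezedState he r
  have h1 : ∀ k : ι ⊕ ι, quadratureSq (quadInl k) (squeezedState he r) ≤
      ENNReal.ofReal (Real.cosh (2 * r (Sum.elim id id k)) / 2) := by
    intro k
    refine quadratureSq_le hnorm (Real.cosh_pos _).le fun t => ?_
    rw [single_quadInl, inner_squeezedState_weyl_inl, Complex.exp_ofReal_re]
    refine Real.exp_le_exp.2 (le_of_eq ?_)
    rcases k with k | k <;> simp [Pi.single_apply, mul_comm]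
  have h2 : ∀ k : κ ⊕ κ, quadratureSq (quadInr k) (squeezedState he r) ≤
      ENNReal.ofReal (Real.cosh (2 * Function.extend e r 0 (Sum.elim id id k)) / 2) := by
    intro k
    refine quadratureSq_le hnorm (Real.cosh_pos _).le fun t => ?_
    rw [single_quadInr, inner_squeezedState_weyl_inr, Complex.exp_ofReal_re]
    refine Real.exp_le_exp.2 (le_of_eq ?_)
    rcases k with k | k <;> simp [Pi.single_apply, mul_comm]
  have hpos : ∀ x : ℝ, 0 ≤ Real.cosh x / 2 := fun x => by have := Real.cosh_pos x; positivity
  rw [energy, sum_quad]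
  refine (ENNReal.div_le_div_right (add_le_add (Finset.sum_le_sum fun k _ => h1 k)
    (Finset.sum_le_sum fun k _ => h2 k)) 2).trans_eq ?_
  rw [← ENNReal.ofReal_sum_of_nonneg fun k _ => hpos _,
    ← ENNReal.ofReal_sum_of_nonneg fun k _ => hpos _,
    ← ENNReal.ofReal_add (Finset.sum_nonneg fun k _ => hpos _)
        (Finset.sum_nonneg fun k _ => hpos _),
    show (2 : ℝ≥0∞) = ENNReal.ofReal 2 by simp, ← ENNReal.ofReal_div_of_pos (by norm_num),
    squeezedEnergy]
  congr 2
  simp only [Fintype.sum_sum_type, Sum.elim_inl, Sum.elim_inr, id, ← Finset.sum_div]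
  ring

theorem squeezedEnergy_le_energy_of_local (he : Function.Injective e) {i j : ι} (hij : i ≠ j)
    (a b : ℝ) {U : ModeSpace (ι ⊕ κ) ≃ₗᵢ[ℂ] ModeSpace (ι ⊕ κ)} (hU : IsLocalGaussianUnitary U) :
    ENNReal.ofReal (squeezedEnergy e (twoSingle i j a b)) ≤
      energy (U (squeezedState he (twoSingle i j a b))) := by
  set r := twoSingle i j a b
  set ψ := squeezedState he r with hψ
  have hnorm : ‖U ψ‖ = 1 := by rw [LinearIsometryEquiv.norm_map, norm_squeezedState]
  obtain ⟨S₁, hS₁, S₂, hS₂, θ, hweyl⟩ := hU.exists_weyl (α := ℕ × ℕ)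
  have hW := fun c => hweyl c ψ _ _ _ (hasSum_schmidt he hij a b)
  have hre : ∀ c (x : ℝ), inner ℂ ψ (weyl (joinPhase (S₁ᵀ *ᵥ resInl c) (S₂ᵀ *ᵥ resInr c)) ψ) =
      Complex.exp (x : ℂ) → (inner ℂ (U ψ) (weyl c (U ψ))).re ≤ Real.exp x := by
    intro c x hx
    rw [hW, inner_smul_right, LinearIsometryEquiv.inner_map_map, hx]
    refine (Complex.re_le_norm _).trans ?_
    rw [norm_mul, mul_comm Complex.I, Complex.norm_exp_ofReal_mul_I, one_mul, Complex.norm_exp,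
      Complex.ofReal_re]
  have hT : ∀ {σ : Type} [Fintype σ] [DecidableEq σ] (S : Matrix σ σ ℝ) (k l : σ) (t : ℝ),
      (Sᵀ *ᵥ (Pi.single k t : σ → ℝ)) l = t * S k l := by
    intro σ _ _ S k l t
    simp [Matrix.mulVec_single, mul_comm]
  set D₁ : ι → ℝ := fun i => Real.cosh (2 * r i) with hD₁
  set D₂ : κ → ℝ := fun j => Real.cosh (2 * Function.extend e r 0 j) with hD₂
  have hD₁0 : ∀ i, 0 ≤ D₁ i := fun i => (Real.cosh_pos _).le
  have hD₂0 : ∀ j, 0 ≤ D₂ j := fun j => (Real.cosh_pos _).le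
  set v₁ : ι ⊕ ι → ℝ := fun k => ∑ i, D₁ i * (S₁ k (Sum.inl i) ^ 2 + S₁ k (Sum.inr i) ^ 2)
  set v₂ : κ ⊕ κ → ℝ := fun k => ∑ j, D₂ j * (S₂ k (Sum.inl j) ^ 2 + S₂ k (Sum.inr j) ^ 2)
  have hv₁ : ∀ k, 0 ≤ v₁ k := fun k =>
    Finset.sum_nonneg fun i _ => mul_nonneg (hD₁0 i) (by positivity)
  have hv₂ : ∀ k, 0 ≤ v₂ k := fun k =>
    Finset.sum_nonneg fun j _ => mul_nonneg (hD₂0 j) (by positivity)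
  have h1 : ∀ k : ι ⊕ ι, ENNReal.ofReal (v₁ k / 2) ≤ quadratureSq (quadInl k) (U ψ) := by
    intro k
    refine le_quadratureSq hnorm (hv₁ k) fun t => hre _ _ ?_
    rw [single_quadInl, resInl_joinPhase, resInr_joinPhase, Matrix.mulVec_zero, hψ,
      inner_squeezedState_weyl_inl]
    congr 4
    simp only [hT, v₁, Finset.mul_sum]
    refine Finset.sum_congr rfl fun i _ => ?_
    ring
  have h2 : ∀ k : κ ⊕ κ, ENNReal.ofReal (v₂ k / 2) ≤ quadratureSq (quadInr k) (U ψ) := by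
    intro k
    refine le_quadratureSq hnorm (hv₂ k) fun t => hre _ _ ?_
    rw [single_quadInr, resInl_joinPhase, resInr_joinPhase, Matrix.mulVec_zero, hψ,
      inner_squeezedState_weyl_inr]
    congr 4
    simp only [hT, v₂, Finset.mul_sum]
    refine Finset.sum_congr rfl fun i _ => ?_
    ring
  have ht₁ : 2 * ∑ i, D₁ i ≤ ∑ k, v₁ k := two_mul_sum_le_of_symplectic hS₁ hD₁0
  have ht₂ : 2 * ∑ j, D₂ j ≤ ∑ k, v₂ k := two_mul_sum_le_of_symplectic hS₂ hD₂0
  rw [energy, sum_quad]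
  refine le_trans ?_ (ENNReal.div_le_div_right (add_le_add (Finset.sum_le_sum fun k _ => h1 k)
    (Finset.sum_le_sum fun k _ => h2 k)) 2)
  have hp₁ : ∀ k, 0 ≤ v₁ k / 2 := fun k => by linarith [hv₁ k]
  have hp₂ : ∀ k, 0 ≤ v₂ k / 2 := fun k => by linarith [hv₂ k]
  rw [← ENNReal.ofReal_sum_of_nonneg fun k _ => hp₁ k,
    ← ENNReal.ofReal_sum_of_nonneg fun k _ => hp₂ k,
    ← ENNReal.ofReal_add (Finset.sum_nonneg fun k _ => hp₁ k) (Finset.sum_nonneg fun k _ => hp₂ k),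
    show (2 : ℝ≥0∞) = ENNReal.ofReal 2 by simp, ← ENNReal.ofReal_div_of_pos (by norm_num)]
  refine ENNReal.ofReal_le_ofReal ?_
  rw [← Finset.sum_div, ← Finset.sum_div, squeezedEnergy]
  linarith

theorem squeezedEnergy_nonneg {ι κ : Type} [Fintype ι] [Fintype κ] (e : ι → κ) (r : ι → ℝ) :
    0 ≤ squeezedEnergy e r :=
  div_nonneg (add_nonneg (Finset.sum_nonneg fun _ _ => (Real.cosh_pos _).le)
    (Finset.sum_nonneg fun _ _ => (Real.cosh_pos _).le)) zero_le_two

theorem squeezedEnergy_twoSingle (he : Function.Injective e) {i j : ι} (hij : i ≠ j) (a b : ℝ) :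
    squeezedEnergy e (twoSingle i j a b) =
      ((Fintype.card ι + Fintype.card κ : ℝ)) / 2 + 2 * (Real.sinh a ^ 2 + Real.sinh b ^ 2) := by
  set r := twoSingle i j a b with hr
  have hc : ∀ x : ℝ, Real.cosh (2 * x) = 1 + 2 * Real.sinh x ^ 2 := fun x => by
    rw [Real.cosh_two_mul, Real.cosh_sq]; ring
  have h1 : ∑ i, Real.sinh (r i) ^ 2 = Real.sinh a ^ 2 + Real.sinh b ^ 2 := by
    rw [Fintype.sum_eq_add i j hij, hr, twoSingle_left hij, twoSingle_right hij]
    rintro k ⟨hi, hj⟩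
    rw [hr, twoSingle_of_ne hi hj]
    simp
  have h2 : ∑ j, Real.sinh (Function.extend e r 0 j) ^ 2 = ∑ i, Real.sinh (r i) ^ 2 := by
    rw [sum_eq_sum_apply_add_sum_compl he, Finset.sum_eq_zero
      (s := (Finset.univ.map ⟨e, he⟩)ᶜ), add_zero]
    · simp only [he.extend_apply]
    · intro k hk
      rw [Function.extend_apply' _ _ _ (by simpa using hk)]
      simp
  simp only [squeezedEnergy, hc, Finset.sum_add_distrib, ← Finset.mul_sum, h1, h2]
  simp
  ring

/-- The ergotropic gap of the two-mode squeezed vacuum, up to the least energy in its orbit under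
global Gaussian unitaries, which is the one of the vacuum. -/
theorem ergotropicGap_squeezedState (he : Function.Injective e) {i j : ι} (hij : i ≠ j) (a b : ℝ) :
    ergotropicGap (squeezedState he (twoSingle i j a b)) =
      ((Fintype.card ι + Fintype.card κ : ℝ)) / 2 + 2 * (Real.sinh a ^ 2 + Real.sinh b ^ 2) -
      (⨅ U : {U : ModeSpace (ι ⊕ κ) ≃ₗᵢ[ℂ] ModeSpace (ι ⊕ κ) // IsGaussianUnitary U},
        energy (U.1 (numState 0))).toReal := by
  have hloc : ⨅ U : {U : ModeSpace (ι ⊕ κ) ≃ₗᵢ[ℂ] ModeSpace (ι ⊕ κ) // IsLocalGaussianUnitary U},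
      energy (U.1 (squeezedState he (twoSingle i j a b))) =
      ENNReal.ofReal (squeezedEnergy e (twoSingle i j a b)) :=
    le_antisymm ((iInf_le (fun U : {U : ModeSpace (ι ⊕ κ) ≃ₗᵢ[ℂ] ModeSpace (ι ⊕ κ) //
        IsLocalGaussianUnitary U} => energy (U.1 (squeezedState he (twoSingle i j a b))))
        ⟨LinearIsometryEquiv.refl ℂ _, .refl⟩).trans (energy_squeezedState_le he _))
      (le_iInf fun U => squeezedEnergy_le_energy_of_local he hij a b U.2)
  have hglob := iInf_energy_orbit (isGaussianUnitary_squeezeUnitary he (twoSingle i j a b))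
    (isGaussianUnitary_squeezeUnitary_symm he (twoSingle i j a b)) (numState 0)
  rw [ergotropicGap, globalErgotropy, localErgotropy, hloc, ENNReal.toReal_ofReal
    (squeezedEnergy_nonneg _ _), ← squeezedEnergy_twoSingle he hij, ← hglob, squeezedState]
  ring

end Energy

end GaussianModes

end

theorem mainTheorem10 (m₁ m₂ : ℕ) (hm₁ : 2 ≤ m₁) (hm₁₂ : m₁ ≤ m₂) :
    ¬ ∃ F : ℝ → ℝ, ∀ ψ : GaussianModes.ModeSpace (Fin m₁ ⊕ Fin m₂),
      GaussianModes.IsPureGaussian ψ →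
        GaussianModes.ergotropicGap ψ = F (GaussianModes.mutualInformation ψ) := by
  rintro ⟨F, hF⟩
  have he : Function.Injective (Fin.castLE hm₁₂) := Fin.castLE_injective hm₁₂
  have hij : (⟨0, by omega⟩ : Fin m₁) ≠ ⟨1, by omega⟩ := by simp
  obtain ⟨b, hb, hb'⟩ := GaussianModes.exists_thermalEntropy_eq_two_mul
  have hsinh : ∀ n : ℝ, 0 ≤ n → Real.sinh (Real.arsinh √n) ^ 2 = n := fun n hn => by
    rw [Real.sinh_arsinh, Real.sq_sqrt hn]
  have hA := hF _ (GaussianModes.isPureGaussian_squeezedState he (GaussianModes.twoSingle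
    ⟨0, by omega⟩ ⟨1, by omega⟩ (Real.arsinh √1) (Real.arsinh √1)))
  have hB := hF _ (GaussianModes.isPureGaussian_squeezedState he (GaussianModes.twoSingle
    ⟨0, by omega⟩ ⟨1, by omega⟩ (Real.arsinh √b) (Real.arsinh √0)))
  rw [GaussianModes.mutualInformation_squeezedState he hij,
    GaussianModes.ergotropicGap_squeezedState he hij] at hA hB
  rw [hsinh 1 zero_le_one] at hA
  rw [hsinh b (by linarith), hsinh 0 le_rfl, hb',
    show GaussianModes.thermalEntropy 0 = 0 by simp [GaussianModes.thermalEntropy], add_zero,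
    two_mul (GaussianModes.thermalEntropy 1), add_zero, ← hA] at hB
  linarith
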